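/- Let $n\ge 2$. Let $T_n$ be the group of orientation-preserving piecewise-linear homeomorphisms of the circle $S^1=[0,1]/(0\sim 1)$ which map the intervals of some $n$-adic subdivision of $S^1$ affinely onto the intervals of another $n$-adic subdivision. Here an $n$-adic subdivision is the partition into subintervals given by the leaves of a finite rooted $n$-ary tree. Elements of $T_n$ are represented by labelled $n$-ary tree pairs: two $n$-ary trees with equally many leaves, the leaves of each being labelled cyclically by $0,1,2,\dots$; the interval of the source leaf with a given label is mapped affinely onto the interval of the target leaf with the same label. Replacing every $n$-caret of both trees by the all-right binary tree with $n$ leaves, and keeping the labels of the leaves, induces an injective group homomorphism $\varphi_*:T_n\to T_2$. Let $\Sigma_n=\{x_0,\dots,x_{n-1},c_0\}\subset T_n$ be given by the following tree pairs. For $0\le i\le n-2$, both trees of $x_i$ have two carets, the lower caret hanging from the $i$-th leaf of the top caret in the source tree (counting leaves from $0$) and from the last leaf of the top caret in the target tree. The trees of $x_{n-1}$ are obtained by hanging the trees of $x_0$ from the last leaf of an $n$-caret. In all of these the leaves are labelled from left to right. For $c_0$ both trees are a single $n$-caret, and the labels of the target tree are those of the source tree shifted cyclically to the left by one. (For $n=2$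 this gives $\{x_0,x_1,c_0\}\subset T_2$.) Then $\Sigma_n$ generates $T_n$, $\Sigma_2$ generates $T_2$, and $\varphi_*$ is a quasi-isometric embedding with respect to the word metrics $d_{\Sigma_n}(g,h)=|g^{-1}h|_{\Sigma_n}$ and $d_{\Sigma_2}$: for all $g,h\in T_n$, $$\frac{1}{45}\,d_{\Sigma_n}(g,h)-\frac{(n-1)(n+3)}{15}\;\le\; d_{\Sigma_2}(\varphi_*(g),\varphi_*(h))\;\le\; 45(n-1)\,d_{\Sigma_n}(g,h)+15 .$$ -/

import Mathlib

set_option linter.unusedSectionVars false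

namespace Thompson

/-- Finite rooted `n`-ary trees: `leaf` is the one-vertex tree and `node c` is an `n`-caret whose
`j`-th leaf (from the left) has been replaced by the tree `c j`. -/
inductive NTree (n : ℕ) : Type
  | leaf : NTree n
  | node : (Fin n → NTree n) → NTree n

namespace NTree

/-- The leaves of a tree from left to right; a leaf is given by its address, the word of the
directions taken on the path from the root to it. -/
def leaves {n : ℕ} : NTree n → List (List (Fin n))
  | leaf => [[]]
  | node c => (List.finRange n).flatMap fun j => (leaves (c j)).map fun w => j :: w

/-- The number of leaves. -/
def numLeaves {n : ℕ} (t : NTree n) : ℕ := t.leaves.length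

/-- The tree with a single `n`-caret. -/
def caret (n : ℕ) : NTree n := node fun _ => leaf

/-- The tree with two `n`-carets, the second one hanging from the `i`-th leaf of the first one. -/
def twoCarets (n i : ℕ) : NTree n := node fun j => if (j : ℕ) = i then caret n else leaf

/-- The tree consisting of an `n`-caret with the tree `s` hanging from its rightmost leaf. -/
def underLast (n : ℕ) (s : NTree n) : NTree n := node fun j => if (j : ℕ) = n - 1 then s else leaf

/-- The all-right binary tree with `m` leaves (every caret other than the top one hangs from the
rightmost leaf of the previous one), with the tree `c j` hanging from its `j`-th leaf.
(The value for `m = 0` is irrelevant.) -/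
def rightComb : (m : ℕ) → (Fin m → NTree 2) → NTree 2
  | 0, _ => leaf
  | 1, c => c 0
  | m + 2, c => node ![c 0, rightComb (m + 1) fun j => c j.succ]

/-- Replace every `n`-caret of a tree by the all-right binary tree with `n` leaves. -/
def caretReplace {n : ℕ} : NTree n → NTree 2
  | leaf => leaf
  | node c => rightComb n fun j => caretReplace (c j)

end NTree

/-- The left endpoint of the `n`-adic subinterval of `[0,1]` that belongs to the vertex with
address `w`. -/
noncomputable def left {n : ℕ} : List (Fin n) → ℝ
  | [] => 0
  | j :: w => ((j : ℕ) + left w) / n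

/-- The length of the `n`-adic subinterval of `[0,1]` that belongs to the vertex with
address `w`. -/
noncomputable def len {n : ℕ} (w : List (Fin n)) : ℝ := ((n : ℝ) ^ w.length)⁻¹

/-- For `t ∈ [0,1]`, the point of the circle `ℝ / ℤ = [0,1] / (0 ~ 1)` that divides the `n`-adic
interval of address `w` in the ratio `t : 1 - t`. -/
noncomputable def point {n : ℕ} (w : List (Fin n)) (t : ℝ) : UnitAddCircle :=
  ((left w + t * len w : ℝ) : UnitAddCircle)

/-- An `n`-ary tree with a cyclic labelling of its leaves by `0, 1, 2, …`: some leaf (the one in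
position `zero`, counted cyclically from the left) gets the label `0`, and the labelling
continues to the right, and then from the leftmost leaf on. -/
structure LabelledTree (n : ℕ) where
  tree : NTree n
  zero : ℕ

/-- The leaves of a labelled tree, listed in the order of their labels. -/
def LabelledTree.labelled {n : ℕ} (t : LabelledTree n) : List (List (Fin n)) :=
  t.tree.leaves.rotate t.zero

/-- A labelled `n`-ary tree pair: two cyclically labelled trees with equally many leaves. -/
structure TreePair (n : ℕ) where
  source : LabelledTree n
  target : LabelledTree n
  numLeaves_eq : source.tree.numLeaves = target.tree.numLeaves

/-- The list of the pairs (leaf of the source tree, leaf of the target tree) with equal labels. -/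
def TreePair.pairs {n : ℕ} (P : TreePair n) : List (List (Fin n) × List (Fin n)) :=
  P.source.labelled.zip P.target.labelled

/-- The map `f` of the circle sends, for each label, the interval of the source leaf with this
label to the interval of the target leaf with this label by the increasing affine bijection. -/
def TreePair.Represents {n : ℕ} (P : TreePair n) (f : UnitAddCircle ≃ₜ UnitAddCircle) : Prop :=
  ∀ p ∈ P.pairs, ∀ t ∈ Set.Icc (0 : ℝ) 1, f (point p.1 t) = point p.2 t

/-! ### Helper facts: trees and their leaves -/

namespace NTree

/-- Hang the tree `g w` from the leaf with address `w`. -/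
def graft {n : ℕ} : NTree n → (List (Fin n) → NTree n) → NTree n
  | leaf, g => g []
  | node c, g => node fun j => graft (c j) fun w => g (j :: w)

theorem leaves_graft {n : ℕ} (U : NTree n) : ∀ g : List (Fin n) → NTree n,
    (U.graft g).leaves = U.leaves.flatMap fun w => (g w).leaves.map fun s => w ++ s := by
  induction U with
  | leaf => intro g; simp [graft, leaves]
  | node c ih =>
    intro g
    simp only [graft, leaves, List.flatMap_assoc]
    congr 1
    funext j
    rw [ih j, List.map_flatMap, List.flatMap_map]
    simp [Function.comp_def]

theorem graft_leaf {n : ℕ} (U : NTree n) : U.graft (fun _ => leaf) = U := by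
  induction U with
  | leaf => rfl
  | node c ih => simp [graft, ih]

theorem exists_common {n : ℕ} (U : NTree n) :
    ∀ U' : NTree n, ∃ g g', U.graft g = U'.graft g' := by
  induction U with
  | leaf => intro U'; exact ⟨fun _ => U', fun _ => leaf, by rw [graft_leaf]; rfl⟩
  | node c ih =>
    intro U'
    cases U' with
    | leaf => exact ⟨fun _ => leaf, fun _ => node c, by rw [graft_leaf]; rfl⟩
    | node c' =>
      choose g g' h using fun j => ih j (c' j)
      refine ⟨fun w => match w with | [] => leaf | j :: w => g j w,
        fun w => match w with | [] => leaf | j :: w => g' j w, ?_⟩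
      simp [graft, h]

theorem nodup_leaves {n : ℕ} (U : NTree n) : U.leaves.Nodup := by
  induction U with
  | leaf => simp [leaves]
  | node c ih =>
    rw [leaves, List.nodup_flatMap]
    refine ⟨fun j _ => (ih j).map fun a b h => by simpa using h, ?_⟩
    refine (List.nodup_finRange n).imp ?_
    intro i j hij w hi hj
    simp only [List.mem_map] at hi hj
    obtain ⟨a, -, rfl⟩ := hi
    obtain ⟨b, -, h⟩ := hj
    simp only [List.cons.injEq] at h
    exact hij h.1.symm

/-- Addresses of the leaves of the all-right binary tree. -/
def combCode : (m : ℕ) → Fin m → List (Fin 2)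
  | 0, _ => []
  | 1, _ => []
  | m + 2, j => Fin.cases [0] (fun i => 1 :: combCode (m + 1) i) j

theorem leaves_rightComb (m : ℕ) : ∀ c : Fin (m + 1) → NTree 2,
    (rightComb (m + 1) c).leaves =
      (List.finRange (m + 1)).flatMap fun j => (c j).leaves.map fun w => combCode (m + 1) j ++ w := by
  induction m with
  | zero => intro c; simp [rightComb, combCode, List.finRange_succ]
  | succ m ih =>
    intro c
    rw [rightComb, leaves, List.finRange_succ (n := m + 1)]
    simp [List.finRange_succ (n := 1), List.finRange_succ (n := 0), ih, combCode, List.flatMap_map,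
      List.map_flatMap, Function.comp_def]

/-- The effect of the caret replacement on addresses. -/
def code {n : ℕ} (w : List (Fin n)) : List (Fin 2) := w.flatMap (combCode n)

theorem code_append {n : ℕ} (w s : List (Fin n)) : code (w ++ s) = code w ++ code s := by
  simp [code]

theorem leaves_caretReplace {n : ℕ} [NeZero n] (U : NTree n) :
    U.caretReplace.leaves = U.leaves.map code := by
  induction U with
  | leaf => simp [caretReplace, leaves, code]
  | node c ih =>
    obtain ⟨m, rfl⟩ := Nat.exists_eq_succ_of_ne_zero (NeZero.ne n)
    rw [caretReplace, leaves_rightComb, leaves, List.map_flatMap]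
    congr 1
    funext j
    rw [ih j]
    simp [code, Function.comp_def]

theorem numLeaves_caretReplace {n : ℕ} [NeZero n] (U : NTree n) :
    U.caretReplace.numLeaves = U.numLeaves := by
  simp [numLeaves, leaves_caretReplace]

theorem numLeaves_node {n : ℕ} (c : Fin n → NTree n) :
    (node c).numLeaves = ∑ j, (c j).numLeaves := by
  simp [numLeaves, leaves, List.length_flatMap, Fin.sum_univ_def]

theorem sum_ite_numLeaves {n i : ℕ} (hi : i < n) (s : NTree n) :
    ∑ j : Fin n, (if (j : ℕ) = i then s else leaf).numLeaves = s.numLeaves + (n - 1) := by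
  rw [← Finset.add_sum_erase _ _ (Finset.mem_univ (⟨i, hi⟩ : Fin n))]
  have h : ∀ j ∈ Finset.univ.erase (⟨i, hi⟩ : Fin n),
      (if (j : ℕ) = i then s else leaf).numLeaves = 1 := by
    intro j hj
    have : (j : ℕ) ≠ i := fun h => (Finset.ne_of_mem_erase hj) (Fin.ext h)
    simp [this, numLeaves, leaves]
  rw [Finset.sum_congr rfl h]
  simp

theorem numLeaves_twoCarets {n i : ℕ} (hi : i < n) :
    (twoCarets n i).numLeaves = (caret n).numLeaves + (n - 1) := by
  rw [twoCarets, numLeaves_node, sum_ite_numLeaves hi]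

theorem numLeaves_underLast {n : ℕ} [NeZero n] (s : NTree n) :
    (underLast n s).numLeaves = s.numLeaves + (n - 1) := by
  rw [underLast, numLeaves_node, sum_ite_numLeaves (Nat.sub_lt (NeZero.pos n) one_pos)]

end NTree

/-! ### Helper facts: intervals -/

theorem len_append {n : ℕ} (w s : List (Fin n)) : len (w ++ s) = len w * len s := by
  simp [len, pow_add, mul_comm]

theorem len_cons {n : ℕ} (j : Fin n) (w : List (Fin n)) : len (j :: w) = len w / n := by
  simp [len, pow_succ, div_eq_mul_inv, mul_comm]

theorem left_append {n : ℕ} (w s : List (Fin n)) : left (w ++ s) = left w + len w * left s := by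
  induction w with
  | nil => simp [left, len]
  | cons j w ih => rw [List.cons_append, left, ih, left, len_cons]; ring

theorem point_append {n : ℕ} (w s : List (Fin n)) (t : ℝ) :
    point (w ++ s) t = point w (left s + t * len s) := by
  unfold point
  rw [left_append, len_append]
  congr 1
  ring

section

variable {n : ℕ} [NeZero n]

theorem len_pos (w : List (Fin n)) : 0 < len w := by
  have : (0 : ℝ) < n := by exact_mod_cast NeZero.pos n
  unfold len
  positivity

theorem left_nonneg (w : List (Fin n)) : 0 ≤ left w := by
  induction w with
  | nil => simp [left]
  | cons j w ih => rw [left]; positivity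

theorem left_add_len_le (w : List (Fin n)) : left w + len w ≤ 1 := by
  have hn : (0 : ℝ) < n := by exact_mod_cast NeZero.pos n
  induction w with
  | nil => simp [left, len]
  | cons j w ih =>
    have hj : ((j : ℕ) : ℝ) + 1 ≤ n := by exact_mod_cast j.2
    rw [left, len_cons, ← add_div, div_le_one hn]
    linarith

theorem sub_mem (s : List (Fin n)) {t : ℝ} (ht : t ∈ Set.Icc (0 : ℝ) 1) :
    left s + t * len s ∈ Set.Icc (0 : ℝ) 1 := by
  have h1 := left_nonneg s
  have h2 := left_add_len_le s
  have h3 := len_pos s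
  obtain ⟨h4, h5⟩ := ht
  constructor <;> nlinarith

theorem cover (U : NTree n) : ∀ y ∈ Set.Icc (0 : ℝ) 1,
    ∃ w ∈ U.leaves, ∃ t ∈ Set.Icc (0 : ℝ) 1, y = left w + t * len w := by
  have hn : (0 : ℝ) < n := by exact_mod_cast NeZero.pos n
  induction U with
  | leaf => intro y hy; exact ⟨[], by simp [NTree.leaves], y, hy, by simp [left, len]⟩
  | node c ih =>
    intro y hy
    obtain ⟨j, hj1, hj2⟩ : ∃ j : Fin n, ((j : ℕ) : ℝ) ≤ n * y ∧ n * y ≤ (j : ℕ) + 1 := by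
      by_cases h : y = 1
      · refine ⟨⟨n - 1, Nat.sub_lt (NeZero.pos n) one_pos⟩, ?_⟩
        have e : (((n - 1 : ℕ) : ℝ)) = n - 1 := Nat.cast_pred (NeZero.pos n)
        simp only [h, e]
        constructor <;> linarith
      · have hy1 : y < 1 := lt_of_le_of_ne hy.2 h
        have h0 : 0 ≤ n * y := mul_nonneg hn.le hy.1
        refine ⟨⟨⌊n * y⌋₊, ?_⟩, Nat.floor_le h0, (Nat.lt_floor_add_one _).le⟩
        rw [Nat.floor_lt h0]
        nlinarith
    obtain ⟨w, hw, t, ht, h⟩ := ih j (n * y - (j : ℕ)) ⟨by linarith, by linarith⟩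
    refine ⟨j :: w, ?_, t, ht, ?_⟩
    · simp only [NTree.leaves, List.mem_flatMap, List.mem_map]
      exact ⟨j, List.mem_finRange j, w, hw, rfl⟩
    · rw [left, len_cons]
      field_simp
      linarith

theorem cover_circle (U : NTree n) (x : UnitAddCircle) :
    ∃ w ∈ U.leaves, ∃ t ∈ Set.Icc (0 : ℝ) 1, x = point w t := by
  have hx : x ∈ ((↑) : ℝ → UnitAddCircle) '' Set.Icc 0 (0 + 1) := by
    rw [AddCircle.coe_image_Icc_eq]; trivial
  obtain ⟨y, hy, rfl⟩ := hx
  rw [zero_add] at hy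
  obtain ⟨w, hw, t, ht, h⟩ := cover U y hy
  exact ⟨w, hw, t, ht, by rw [point, ← h]⟩

/-- The intervals of a list of addresses are adjacent and go from `a` to `b`. -/
def Contig : List (List (Fin n)) → ℝ → ℝ → Prop
  | [], a, b => a = b
  | w :: L, a, b => left w = a ∧ Contig L (left w + len w) b

/-- The same on the circle. -/
def ContigC : List (List (Fin n)) → UnitAddCircle → UnitAddCircle → Prop
  | [], x, y => x = y
  | w :: L, x, y => (left w : UnitAddCircle) = x ∧
      ContigC L ((left w + len w : ℝ) : UnitAddCircle) y

theorem Contig.append {L L' : List (List (Fin n))} : ∀ {a b c : ℝ}, Contig L a b →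
    Contig L' b c → Contig (L ++ L') a c := by
  induction L with
  | nil => intro a b c h h'; cases h; exact h'
  | cons w L ih => intro a b c h h'; exact ⟨h.1, ih h.2 h'⟩

theorem ContigC.append {L L' : List (List (Fin n))} : ∀ {a b c : UnitAddCircle}, ContigC L a b →
    ContigC L' b c → ContigC (L ++ L') a c := by
  induction L with
  | nil => intro a b c h h'; cases h; exact h'
  | cons w L ih => intro a b c h h'; exact ⟨h.1, ih h.2 h'⟩

theorem Contig.split {L L' : List (List (Fin n))} : ∀ {a c : ℝ}, Contig (L ++ L') a c →
    ∃ b, Contig L a b ∧ Contig L' b c := by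
  induction L with
  | nil => intro a c h; exact ⟨a, rfl, h⟩
  | cons w L ih =>
    intro a c h
    obtain ⟨b, h1, h2⟩ := ih h.2
    exact ⟨b, ⟨h.1, h1⟩, h2⟩

theorem Contig.toCircle {L : List (List (Fin n))} : ∀ {a b : ℝ}, Contig L a b →
    ContigC L (a : UnitAddCircle) (b : UnitAddCircle) := by
  induction L with
  | nil => intro a b h; cases h; rfl
  | cons w L ih => intro a b h; exact ⟨by rw [h.1], ih h.2⟩

theorem Contig.le {L : List (List (Fin n))} : ∀ {a b : ℝ}, Contig L a b →
    a ≤ b ∧ ∀ w ∈ L, a ≤ left w := by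
  induction L with
  | nil => intro a b h; cases h; simp
  | cons w L ih =>
    intro a b h
    have h1 := ih h.2
    have h2 := len_pos w
    have h3 := h.1
    refine ⟨by linarith, fun v hv => ?_⟩
    rcases List.mem_cons.1 hv with rfl | hv
    · exact h3.ge
    · linarith [h1.2 v hv]

theorem Contig.map_cons (j : Fin n) {L : List (List (Fin n))} : ∀ {a b : ℝ}, Contig L a b →
    Contig (L.map fun w => j :: w) (((j : ℕ) + a) / n) (((j : ℕ) + b) / n) := by
  induction L with
  | nil => intro a b h; cases h; rfl
  | cons w L ih =>
    intro a b h
    refine ⟨by rw [left, h.1], ?_⟩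
    have := ih h.2
    rw [left, len_cons, ← add_div, add_assoc]
    exact this

theorem contig_leaves (U : NTree n) : Contig U.leaves 0 1 := by
  have hn : (n : ℝ) ≠ 0 := by exact_mod_cast NeZero.ne n
  induction U with
  | leaf => simp [NTree.leaves, Contig, left, len]
  | node c ih =>
    have key : ∀ (k a : ℕ) (l : List (Fin n)), l.map Fin.val = List.range' a k →
        Contig (l.flatMap fun j => (c j).leaves.map fun w => j :: w)
          ((a : ℝ) / n) (((a + k : ℕ) : ℝ) / n) := by
      intro k
      induction k with
      | zero =>
        intro a l h
        have : l = [] := by simpa using h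
        subst this
        simp [Contig]
      | succ k ihk =>
        intro a l h
        cases l with
        | nil => simp [List.range'_succ] at h
        | cons j l =>
          rw [List.range'_succ, List.map_cons, List.cons.injEq] at h
          rw [List.flatMap_cons]
          have h1 := (ih j).map_cons j
          have h2 := ihk (a + 1) l h.2
          rw [h.1] at h1
          refine Contig.append (by simpa using h1) ?_
          have e : a + 1 + k = a + (k + 1) := by ring
          rw [e] at h2
          simpa using h2
    have := key n 0 (List.finRange n) (by
      rw [← List.range_eq_range']; exact List.map_coe_finRange_eq_range)
    simpa [NTree.leaves, hn] using this

end

/-! ### Helper facts: tree pairs as lists of pairs of addresses -/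

/-- `L` lists the equally labelled leaves of some labelled tree pair. -/
def IsPairing {n : ℕ} (L : List (List (Fin n) × List (Fin n))) : Prop :=
  ∃ U V : NTree n, L.map Prod.fst ~r U.leaves ∧ L.map Prod.snd ~r V.leaves

/-- The list form of `TreePair.Represents`. -/
def Rep {n : ℕ} (L : List (List (Fin n) × List (Fin n)))
    (f : UnitAddCircle → UnitAddCircle) : Prop :=
  ∀ p ∈ L, ∀ t ∈ Set.Icc (0 : ℝ) 1, f (point p.1 t) = point p.2 t

theorem TreePair.map_fst_pairs {n : ℕ} (P : TreePair n) :
    P.pairs.map Prod.fst = P.source.labelled := by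
  rw [TreePair.pairs, List.map_fst_zip]
  have := P.numLeaves_eq
  simp only [NTree.numLeaves] at this
  simp [LabelledTree.labelled, this]

theorem TreePair.map_snd_pairs {n : ℕ} (P : TreePair n) :
    P.pairs.map Prod.snd = P.target.labelled := by
  rw [TreePair.pairs, List.map_snd_zip]
  have := P.numLeaves_eq
  simp only [NTree.numLeaves] at this
  simp [LabelledTree.labelled, this]

theorem TreePair.isPairing {n : ℕ} (P : TreePair n) : IsPairing P.pairs :=
  ⟨P.source.tree, P.target.tree, by
    rw [P.map_fst_pairs]; exact List.IsRotated.forall _ _, by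
    rw [P.map_snd_pairs]; exact List.IsRotated.forall _ _⟩

theorem IsPairing.exists_treePair {n : ℕ} {L : List (List (Fin n) × List (Fin n))}
    (h : IsPairing L) : ∃ P : TreePair n, P.pairs = L := by
  obtain ⟨U, V, hU, hV⟩ := h
  have hl : U.numLeaves = V.numLeaves := by
    have h1 := hU.perm.length_eq
    have h2 := hV.perm.length_eq
    simp only [List.length_map] at h1 h2
    rw [NTree.numLeaves, NTree.numLeaves, ← h1, ← h2]
  obtain ⟨k, hk⟩ := hU.symm
  obtain ⟨l, hl'⟩ := hV.symm
  refine ⟨⟨⟨U, k⟩, ⟨V, l⟩, hl⟩, ?_⟩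
  simp only [TreePair.pairs, LabelledTree.labelled]
  rw [hk, hl']
  exact (List.zip_of_prod rfl rfl).symm

theorem IsPairing.swap {n : ℕ} {L : List (List (Fin n) × List (Fin n))} (h : IsPairing L) :
    IsPairing (L.map Prod.swap) := by
  obtain ⟨U, V, hU, hV⟩ := h
  exact ⟨V, U, by simpa [Function.comp_def] using hV, by simpa [Function.comp_def] using hU⟩

theorem exists_factor {α β γ : Type*} [Nonempty γ] {L : List α} {e : α → β}
    (hL : (L.map e).Nodup) (h : α → γ) : ∃ g : β → γ, ∀ p ∈ L, g (e p) = h p := by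
  classical
  refine ⟨fun b => if hb : ∃ p ∈ L, e p = b then h hb.choose else Classical.arbitrary γ, ?_⟩
  intro p hp
  have hb : ∃ q ∈ L, e q = e p := ⟨p, hp, rfl⟩
  simp only [dif_pos hb]
  rw [List.inj_on_of_nodup_map hL hb.choose_spec.1 hp hb.choose_spec.2]

instance {n : ℕ} : Nonempty (NTree n) := ⟨NTree.leaf⟩

/-- Hang the tree `h p` from both leaves of every pair `p`. -/
def expand {n : ℕ} (L : List (List (Fin n) × List (Fin n)))
    (h : List (Fin n) × List (Fin n) → NTree n) : List (List (Fin n) × List (Fin n)) :=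
  L.flatMap fun p => (h p).leaves.map fun s => (p.1 ++ s, p.2 ++ s)

theorem isRotated_flatMap {α β : Type*} {l l' : List α} (h : l ~r l') (f : α → List β) :
    l.flatMap f ~r l'.flatMap f := by
  obtain ⟨k, hk, rfl⟩ := List.isRotated_iff_mod.1 h
  rw [List.rotate_eq_drop_append_take hk, List.flatMap_append]
  conv_lhs => rw [← List.take_append_drop k l, List.flatMap_append]
  exact List.isRotated_append

theorem expand_proj {n : ℕ} (e : List (Fin n) × List (Fin n) → List (Fin n))
    (he : ∀ (p : List (Fin n) × List (Fin n)) s, e (p.1 ++ s, p.2 ++ s) = e p ++ s)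
    {L : List (List (Fin n) × List (Fin n))} {U : NTree n} (hU : L.map e ~r U.leaves)
    (h : List (Fin n) × List (Fin n) → NTree n) (g : List (Fin n) → NTree n)
    (hg : ∀ p ∈ L, g (e p) = h p) : (expand L h).map e ~r (U.graft g).leaves := by
  have h1 : (expand L h).map e =
      (L.map e).flatMap fun w => (g w).leaves.map fun s => w ++ s := by
    rw [expand, List.map_flatMap, List.flatMap_map]
    refine List.flatMap_congr fun p hp => ?_
    rw [hg p hp]
    simp [he, Function.comp_def]
  rw [h1, NTree.leaves_graft]
  exact isRotated_flatMap hU _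

theorem expand_fst {n : ℕ} {L : List (List (Fin n) × List (Fin n))} {U : NTree n}
    (hU : L.map Prod.fst ~r U.leaves) (g : List (Fin n) → NTree n) :
    (expand L fun p => g p.1).map Prod.fst ~r (U.graft g).leaves :=
  expand_proj Prod.fst (fun _ _ => rfl) hU _ g fun _ _ => rfl

theorem expand_snd {n : ℕ} {L : List (List (Fin n) × List (Fin n))} {V : NTree n}
    (hV : L.map Prod.snd ~r V.leaves) (g : List (Fin n) → NTree n) :
    (expand L fun p => g p.2).map Prod.snd ~r (V.graft g).leaves :=
  expand_proj Prod.snd (fun _ _ => rfl) hV _ g fun _ _ => rfl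

theorem IsPairing.expand {n : ℕ} {L : List (List (Fin n) × List (Fin n))} (hL : IsPairing L)
    (h : List (Fin n) × List (Fin n) → NTree n) : IsPairing (expand L h) := by
  obtain ⟨U, V, hU, hV⟩ := hL
  obtain ⟨g, hg⟩ := exists_factor (hU.nodup_iff.2 U.nodup_leaves) h
  obtain ⟨g', hg'⟩ := exists_factor (hV.nodup_iff.2 V.nodup_leaves) h
  exact ⟨_, _, expand_proj Prod.fst (fun _ _ => rfl) hU h g hg,
    expand_proj Prod.snd (fun _ _ => rfl) hV h g' hg'⟩

theorem exists_comp {α : Type*} : ∀ A B : List (α × α), A.map Prod.snd = B.map Prod.fst →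
    ∃ C : List (α × α), C.map Prod.fst = A.map Prod.fst ∧ C.map Prod.snd = B.map Prod.snd ∧
      ∀ p ∈ C, ∃ m, (p.1, m) ∈ A ∧ (m, p.2) ∈ B
  | [], [], _ => ⟨[], by simp⟩
  | [], _ :: _, h => by simp at h
  | _ :: _, [], h => by simp at h
  | a :: A, b :: B, h => by
    simp only [List.map_cons, List.cons.injEq] at h
    obtain ⟨C, h1, h2, h3⟩ := exists_comp A B h.2
    refine ⟨(a.1, b.2) :: C, by simp [h1], by simp [h2], ?_⟩
    intro p hp
    rcases List.mem_cons.1 hp with rfl | hp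
    · exact ⟨a.2, by simp, by simp [h.1]⟩
    · obtain ⟨m, hm1, hm2⟩ := h3 p hp
      exact ⟨m, List.mem_cons_of_mem _ hm1, List.mem_cons_of_mem _ hm2⟩

/-- The composition of two tree pairs through a common expansion of the middle trees. -/
theorem IsPairing.comp {n : ℕ} {L L' : List (List (Fin n) × List (Fin n))} (hL : IsPairing L)
    (hL' : IsPairing L') : ∃ M, IsPairing M ∧ ∀ p ∈ M, ∃ a b c d s s', (a, b) ∈ L ∧ (c, d) ∈ L' ∧
      b ++ s = c ++ s' ∧ p = (a ++ s, d ++ s') := by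
  obtain ⟨U, V, hU, hV⟩ := id hL
  obtain ⟨U', V', hU', hV'⟩ := id hL'
  obtain ⟨g, g', hg⟩ := V.exists_common U'
  obtain ⟨U₁, -, hU₁, -⟩ := hL.expand fun p => g p.2
  obtain ⟨-, V₁, -, hV₁⟩ := hL'.expand fun p => g' p.1
  have h1 := expand_snd hV g
  have h2 := expand_fst hU' g'
  rw [← hg] at h2
  obtain ⟨k, hk⟩ := h2.trans h1.symm
  obtain ⟨M, hM1, hM2, hM3⟩ := exists_comp (Thompson.expand L fun p => g p.2)
    ((Thompson.expand L' fun p => g' p.1).rotate k) (by rw [List.map_rotate, hk])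
  refine ⟨M, ⟨U₁, V₁, by rwa [hM1], ?_⟩, ?_⟩
  · rw [hM2, List.map_rotate]
    exact (List.IsRotated.forall _ _).trans hV₁
  · intro p hp
    obtain ⟨m, h3, h4⟩ := hM3 p hp
    rw [List.mem_rotate] at h4
    simp only [Thompson.expand, List.mem_flatMap, List.mem_map, Prod.mk.injEq] at h3 h4
    obtain ⟨⟨a, b⟩, hab, s, -, e1, e2⟩ := h3
    obtain ⟨⟨c, d⟩, hcd, s', -, e3, e4⟩ := h4
    exact ⟨a, b, c, d, s, s', hab, hcd, e2.trans e3.symm, Prod.ext e1.symm e4.symm⟩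

/-- The caret replacement on the level of addresses. -/
def codeList {n : ℕ} (L : List (List (Fin n) × List (Fin n))) :
    List (List (Fin 2) × List (Fin 2)) := L.map (Prod.map NTree.code NTree.code)

section

variable {n : ℕ} [NeZero n]

theorem IsPairing.codeList {L : List (List (Fin n) × List (Fin n))} (hL : IsPairing L) :
    IsPairing (codeList L) := by
  obtain ⟨U, V, hU, hV⟩ := hL
  refine ⟨U.caretReplace, V.caretReplace, ?_, ?_⟩
  · rw [NTree.leaves_caretReplace]
    simpa [Thompson.codeList, Function.comp_def] using hU.map NTree.code
  · rw [NTree.leaves_caretReplace]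
    simpa [Thompson.codeList, Function.comp_def] using hV.map NTree.code

theorem Rep.apply_append {L : List (List (Fin n) × List (Fin n))} {f : UnitAddCircle → UnitAddCircle}
    (hf : Rep L f) {a b : List (Fin n)} (hab : (a, b) ∈ L) (s : List (Fin n)) {t : ℝ}
    (ht : t ∈ Set.Icc (0 : ℝ) 1) : f (point (a ++ s) t) = point (b ++ s) t := by
  rw [point_append, point_append]
  exact hf _ hab _ (sub_mem s ht)

theorem Rep.ext {L : List (List (Fin n) × List (Fin n))} (hL : IsPairing L)
    {f g : UnitAddCircle → UnitAddCircle} (hf : Rep L f) (hg : Rep L g) : f = g := by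
  obtain ⟨U, V, hU, hV⟩ := hL
  funext x
  obtain ⟨w, hw, t, ht, rfl⟩ := cover_circle U x
  rw [← hU.mem_iff, List.mem_map] at hw
  obtain ⟨p, hp, rfl⟩ := hw
  rw [hf p hp t ht, hg p hp t ht]

theorem Rep.swap {L : List (List (Fin n) × List (Fin n))} {f : UnitAddCircle ≃ₜ UnitAddCircle}
    (hf : Rep L f) : Rep (L.map Prod.swap) f.symm := by
  intro p hp t ht
  simp only [List.mem_map] at hp
  obtain ⟨q, hq, rfl⟩ := hp
  simp only [Prod.fst_swap, Prod.snd_swap]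
  rw [← hf q hq t ht, Homeomorph.symm_apply_apply]

theorem exists_glue (L : List (List (Fin n) × List (Fin n))) :
    ∀ {a b : ℝ} {x y : UnitAddCircle}, Contig (L.map Prod.fst) a b →
      ContigC (L.map Prod.snd) x y → ∃ G : ℝ → UnitAddCircle, Continuous G ∧ G a = x ∧ G b = y ∧
        ∀ p ∈ L, ∀ t ∈ Set.Icc (0 : ℝ) 1, G (left p.1 + t * len p.1) = point p.2 t := by
  induction L with
  | nil =>
    intro a b x y h h'
    cases h
    cases h'
    exact ⟨fun _ => x, continuous_const, rfl, rfl, by simp⟩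
  | cons p L ih =>
    intro a b x y h h'
    obtain ⟨G, hG, hGa, hGb, hGL⟩ := ih h.2 h'.2
    have hp := len_pos p.1
    have hle := Contig.le h.2
    have hfirst := h.1
    set F : ℝ → UnitAddCircle := fun z =>
      ((left p.2 + (z - left p.1) / len p.1 * len p.2 : ℝ) : UnitAddCircle) with hF
    have hFc : Continuous F := (AddCircle.continuous_mk' 1).comp (by fun_prop)
    have hFe : F (left p.1 + len p.1) = G (left p.1 + len p.1) := by
      rw [hGa, hF]
      simp [hp.ne']
    have hFt : ∀ t, F (left p.1 + t * len p.1) = point p.2 t := by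
      intro t
      rw [hF]
      simp only [point]
      congr 2
      field_simp
      ring
    have hright : ∀ z, left p.1 + len p.1 ≤ z →
        (if z ≤ left p.1 + len p.1 then F z else G z) = G z := by
      intro z hz
      by_cases hz' : z ≤ left p.1 + len p.1
      · rw [if_pos hz', le_antisymm hz' hz, hFe]
      · rw [if_neg hz']
    refine ⟨fun z => if z ≤ left p.1 + len p.1 then F z else G z, ?_, ?_, ?_, ?_⟩
    · refine Continuous.if_le hFc hG continuous_id continuous_const ?_
      intro z hz
      have hz' : z = left p.1 + len p.1 := hz
      rw [hz', hFe]
    · have h0 := hFt 0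
      have h1 := h'.1
      rw [← hfirst]
      simp only [if_pos (show left p.1 ≤ left p.1 + len p.1 by linarith)]
      rw [← h1]
      simpa [point] using h0
    · exact (hright b hle.1).trans hGb
    · intro q hq t ht
      rcases List.mem_cons.1 hq with rfl | hq
      · have : left q.1 + t * len q.1 ≤ left q.1 + len q.1 := by nlinarith [ht.2]
        simp only [if_pos this]
        exact hFt t
      · have h1 := hle.2 q.1 (List.mem_map.2 ⟨q, hq, rfl⟩)
        have h2 := len_pos q.1
        have : left p.1 + len p.1 ≤ left q.1 + t * len q.1 := by nlinarith [ht.1]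
        simp only [hright _ this]
        exact hGL q hq t ht

theorem IsPairing.exists_continuous {L : List (List (Fin n) × List (Fin n))} (hL : IsPairing L) :
    ∃ f : UnitAddCircle → UnitAddCircle, Continuous f ∧ Rep L f := by
  obtain ⟨U, V, ⟨k, hk⟩, hV⟩ := hL
  have hV' : (L.rotate k).map Prod.snd ~r V.leaves := by
    rw [List.map_rotate]
    exact (List.IsRotated.forall _ _).trans hV
  obtain ⟨m, hm, hm'⟩ := List.isRotated_iff_mod.1 hV'.symm
  rw [List.rotate_eq_drop_append_take hm] at hm'
  have hc := contig_leaves V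
  rw [← List.take_append_drop m V.leaves] at hc
  obtain ⟨c, hc1, hc2⟩ := hc.split
  have h1 : ((1 : ℝ) : UnitAddCircle) = ((0 : ℝ) : UnitAddCircle) := by
    rw [AddCircle.coe_period, AddCircle.coe_zero]
  have hc3 := hc2.toCircle
  rw [h1] at hc3
  have hc4 := hc3.append hc1.toCircle
  rw [hm'] at hc4
  have hU : Contig ((L.rotate k).map Prod.fst) 0 1 := by
    rw [List.map_rotate, hk]
    exact contig_leaves U
  obtain ⟨G, hG, hG0, hG1, hGL⟩ := exists_glue _ hU hc4
  have h01 : G 0 = G 1 := hG0.trans hG1.symm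
  refine ⟨AddCircle.liftIco 1 0 G, AddCircle.liftIco_zero_continuous h01 hG.continuousOn, ?_⟩
  have hval : ∀ z ∈ Set.Icc (0 : ℝ) 1, AddCircle.liftIco 1 0 G (z : UnitAddCircle) = G z := by
    intro z hz
    rcases hz.2.lt_or_eq with h | rfl
    · exact AddCircle.liftIco_zero_coe_apply ⟨hz.1, h⟩
    · rw [h1, ← h01]
      exact AddCircle.liftIco_zero_coe_apply ⟨le_rfl, one_pos⟩
  intro p hp t ht
  rw [point, hval _ (sub_mem p.1 ht)]
  exact hGL p (List.mem_rotate.2 hp) t ht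

theorem Rep.swap_comp {L : List (List (Fin n) × List (Fin n))} (hL : IsPairing L)
    {f g : UnitAddCircle → UnitAddCircle} (hf : Rep L f) (hg : Rep (L.map Prod.swap) g) :
    Function.LeftInverse g f := by
  obtain ⟨U, V, hU, hV⟩ := hL
  intro x
  obtain ⟨w, hw, t, ht, rfl⟩ := cover_circle U x
  rw [← hU.mem_iff, List.mem_map] at hw
  obtain ⟨p, hp, rfl⟩ := hw
  rw [hf p hp t ht]
  exact hg p.swap (List.mem_map.2 ⟨p, hp, rfl⟩) t ht

theorem IsPairing.exists_homeomorph {L : List (List (Fin n) × List (Fin n))} (hL : IsPairing L) :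
    ∃ f : UnitAddCircle ≃ₜ UnitAddCircle, Rep L f := by
  obtain ⟨f, hf, hLf⟩ := hL.exists_continuous
  obtain ⟨g, hg, hLg⟩ := hL.swap.exists_continuous
  have hLf' : Rep ((L.map Prod.swap).map Prod.swap) f := by
    simpa [Function.comp_def] using hLf
  exact ⟨⟨⟨f, g, Rep.swap_comp hL hLf hLg, Rep.swap_comp hL.swap hLg hLf'⟩, hf, hg⟩, hLf⟩

/-- Every labelled tree pair represents a homeomorphism of the circle. -/
theorem TreePair.exists_represents (P : TreePair n) :
    ∃ f : UnitAddCircle ≃ₜ UnitAddCircle, P.Represents f := P.isPairing.exists_homeomorph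

/-- `f` and `F` are represented by a tree pair and by its caret replacement, respectively. -/
def Compatible (n : ℕ) (f F : UnitAddCircle ≃ₜ UnitAddCircle) : Prop :=
  ∃ L : List (List (Fin n) × List (Fin n)), IsPairing L ∧ Rep L f ∧ Rep (codeList L) F

theorem Compatible.inv {f F : UnitAddCircle ≃ₜ UnitAddCircle} (h : Compatible n f F) :
    Compatible n f⁻¹ F⁻¹ := by
  obtain ⟨L, hL, hf, hF⟩ := h
  refine ⟨_, hL.swap, hf.swap, ?_⟩
  have := hF.swap
  have e : Thompson.codeList (L.map Prod.swap) = (Thompson.codeList L).map Prod.swap := by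
    simp [Thompson.codeList, Function.comp_def]
  rw [e]
  exact this

theorem mul_apply' (f g : UnitAddCircle ≃ₜ UnitAddCircle) (x : UnitAddCircle) :
    (f * g) x = f (g x) := rfl

theorem Compatible.mul {f F f' F' : UnitAddCircle ≃ₜ UnitAddCircle} (h' : Compatible n f' F')
    (h : Compatible n f F) : Compatible n (f' * f) (F' * F) := by
  obtain ⟨L, hL, hf, hF⟩ := h
  obtain ⟨L', hL', hf', hF'⟩ := h'
  obtain ⟨M, hM, hML⟩ := hL.comp hL'
  refine ⟨M, hM, ?_, ?_⟩
  · intro p hp t ht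
    obtain ⟨a, b, c, d, s, s', hab, hcd, e, rfl⟩ := hML p hp
    rw [mul_apply', hf.apply_append hab s ht, e,
      hf'.apply_append hcd s' ht]
  · intro p hp t ht
    simp only [Thompson.codeList, List.mem_map] at hp
    obtain ⟨p, hp, rfl⟩ := hp
    obtain ⟨a, b, c, d, s, s', hab, hcd, e, rfl⟩ := hML p hp
    have hab' : (NTree.code a, NTree.code b) ∈ Thompson.codeList L := List.mem_map.2 ⟨_, hab, rfl⟩
    have hcd' : (NTree.code c, NTree.code d) ∈ Thompson.codeList L' := List.mem_map.2 ⟨_, hcd, rfl⟩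
    have e' := congrArg NTree.code e
    simp only [NTree.code_append] at e'
    simp only [Prod.map_apply, NTree.code_append]
    rw [mul_apply', hF.apply_append hab' _ ht, e',
      hF'.apply_append hcd' _ ht]

theorem Compatible.one (n : ℕ) [NeZero n] : Compatible n 1 1 := by
  refine ⟨[([], [])], ⟨NTree.leaf, NTree.leaf, by simp [NTree.leaves], by simp [NTree.leaves]⟩,
    ?_, ?_⟩
  · intro p hp t _
    simp only [List.mem_singleton] at hp
    subst hp
    rfl
  · intro p hp t _
    simp only [Thompson.codeList, List.map_cons, List.map_nil, List.mem_singleton] at hp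
    subst hp
    rfl

theorem TreePair.Represents.exists_compatible {P : TreePair n} {f : UnitAddCircle ≃ₜ UnitAddCircle}
    (h : P.Represents f) : ∃ F, Compatible n f F := by
  obtain ⟨F, hF⟩ := P.isPairing.codeList.exists_homeomorph
  exact ⟨F, P.pairs, P.isPairing, h, hF⟩

theorem Compatible.exists_represents {f F : UnitAddCircle ≃ₜ UnitAddCircle}
    (h : Compatible n f F) : ∃ P : TreePair n, P.Represents f := by
  obtain ⟨L, hL, hf, -⟩ := h
  obtain ⟨P, rfl⟩ := hL.exists_treePair
  exact ⟨P, hf⟩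

theorem Compatible.exists_represents' {f F : UnitAddCircle ≃ₜ UnitAddCircle}
    (h : Compatible n f F) : ∃ P : TreePair 2, P.Represents F := by
  obtain ⟨L, hL, -, hF⟩ := h
  obtain ⟨P, hP⟩ := hL.codeList.exists_treePair
  rw [← hP] at hF
  exact ⟨P, hF⟩

end

theorem point_injective {n : ℕ} [n.AtLeastTwo] {w v : List (Fin n)}
    (h : ∀ t ∈ Set.Icc (0 : ℝ) 1, point w t = point v t) : w = v := by
  have hn0 : (0 : ℝ) < n := by exact_mod_cast NeZero.pos n
  have hmem : ∀ (u : List (Fin n)) (t : ℝ), 0 ≤ t → t < 1 →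
      left u + t * len u ∈ Set.Ico (0 : ℝ) (0 + 1) := by
    intro u t h0 h1
    have a1 := left_nonneg u
    have a2 := left_add_len_le u
    have a3 := len_pos u
    constructor <;> nlinarith
  have key : ∀ t : ℝ, 0 ≤ t → t < 1 → left w + t * len w = left v + t * len v := fun t h0 h1 =>
    (AddCircle.coe_eq_coe_iff_of_mem_Ico (hmem w t h0 h1) (hmem v t h0 h1)).1 (h t ⟨h0, h1.le⟩)
  have k0 := key 0 le_rfl one_pos
  have k1 := key (1 / 2) (by norm_num) (by norm_num)
  have hlen : len w = len v := by linarith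
  have hleft : left w = left v := by linarith
  have hl : w.length = v.length := by
    simp only [len, inv_inj] at hlen
    exact pow_right_injective₀ hn0 (by exact_mod_cast (Nat.AtLeastTwo.one_lt (n := n)).ne') hlen
  clear h hmem key k0 k1 hlen
  induction w generalizing v with
  | nil => exact (List.length_eq_zero_iff.1 hl.symm).symm
  | cons i w ih =>
    cases v with
    | nil => simp at hl
    | cons j v =>
      rw [left, left, div_left_inj' hn0.ne'] at hleft
      have b1 := left_nonneg w
      have b2 := left_add_len_le w
      have b3 := len_pos w
      have c1 := left_nonneg v
      have c2 := left_add_len_le v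
      have c3 := len_pos v
      have hij : (i : ℕ) = j := by
        apply le_antisymm
        · have : ((i : ℕ) : ℝ) < (j : ℕ) + 1 := by linarith
          exact Nat.lt_succ_iff.1 (by exact_mod_cast this)
        · have : ((j : ℕ) : ℝ) < (i : ℕ) + 1 := by linarith
          exact Nat.lt_succ_iff.1 (by exact_mod_cast this)
      rw [Fin.ext hij, ih (v := v) (by rw [hij] at hleft; linarith) (by simpa using hl)]

theorem Compatible.eq_one {n : ℕ} [n.AtLeastTwo] {F : UnitAddCircle ≃ₜ UnitAddCircle}
    (h : Compatible n 1 F) : F = 1 := by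
  obtain ⟨L, hL, h1, hF⟩ := h
  have hdiag : ∀ p ∈ L, p.1 = p.2 := fun p hp => point_injective fun t ht => h1 p hp t ht
  have h2 : Rep (codeList L) (1 : UnitAddCircle ≃ₜ UnitAddCircle) := by
    intro p hp t ht
    simp only [codeList, List.mem_map] at hp
    obtain ⟨q, hq, rfl⟩ := hp
    simp only [Prod.map_fst, Prod.map_snd, hdiag q hq]
    rfl
  exact DFunLike.coe_injective (Rep.ext hL.codeList hF h2)

theorem Compatible.unique {n : ℕ} [n.AtLeastTwo] {f F F' : UnitAddCircle ≃ₜ UnitAddCircle}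
    (h : Compatible n f F) (h' : Compatible n f F') : F = F' := by
  have := h'.inv.mul h
  rw [inv_mul_cancel] at this
  exact (inv_mul_eq_one.1 this.eq_one).symm

/-! ### The groups and the caret-replacement embedding -/

/-- The generalised Thompson group `T_n` (`n ≥ 2`): the homeomorphisms of the circle
`[0,1] / (0 ~ 1)` which map the intervals of some `n`-adic subdivision, in cyclic order, onto the
intervals of another one by increasing affine maps. The product is the composition of maps.
(The `n`-adic subdivisions of `[0,1]` are the interval partitions given by the leaves of `n`-ary
trees.) -/
def T (n : ℕ) [n.AtLeastTwo] : Subgroup (UnitAddCircle ≃ₜ UnitAddCircle) where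
  carrier := {f | ∃ P : TreePair n, P.Represents f}
  one_mem' := (Compatible.one n).exists_represents
  mul_mem' := by
    rintro f g ⟨P, hP⟩ ⟨Q, hQ⟩
    obtain ⟨F, hF⟩ := hP.exists_compatible
    obtain ⟨G, hG⟩ := hQ.exists_compatible
    exact (hF.mul hG).exists_represents
  inv_mem' := by
    rintro f ⟨P, hP⟩
    obtain ⟨F, hF⟩ := hP.exists_compatible
    exact hF.inv.exists_represents

/-- The element of `T_n` represented by a labelled tree pair. -/
noncomputable def TreePair.toT {n : ℕ} [n.AtLeastTwo] (P : TreePair n) : T n :=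
  ⟨P.exists_represents.choose, P, P.exists_represents.choose_spec⟩

theorem TreePair.represents_toT {n : ℕ} [n.AtLeastTwo] (P : TreePair n) :
    P.Represents (P.toT : UnitAddCircle ≃ₜ UnitAddCircle) := P.exists_represents.choose_spec

/-- Replace every `n`-caret of both trees of a tree pair by the all-right binary tree with `n`
leaves, and keep the labels of the leaves. -/
def TreePair.caretReplace {n : ℕ} [n.AtLeastTwo] (P : TreePair n) : TreePair 2 where
  source := ⟨P.source.tree.caretReplace, P.source.zero⟩
  target := ⟨P.target.tree.caretReplace, P.target.zero⟩
  numLeaves_eq := by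
    rw [NTree.numLeaves_caretReplace, NTree.numLeaves_caretReplace, P.numLeaves_eq]

theorem TreePair.pairs_caretReplace {n : ℕ} [n.AtLeastTwo] (P : TreePair n) :
    P.caretReplace.pairs = codeList P.pairs := by
  simp only [TreePair.pairs, TreePair.caretReplace, LabelledTree.labelled, codeList,
    NTree.leaves_caretReplace, ← List.map_rotate]
  rw [List.zip_map]

theorem exists_phi {n : ℕ} [n.AtLeastTwo] (f : T n) : ∃ F : T 2, ∃ P : TreePair n,
    P.Represents (f : UnitAddCircle ≃ₜ UnitAddCircle) ∧
      P.caretReplace.Represents (F : UnitAddCircle ≃ₜ UnitAddCircle) := by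
  obtain ⟨f, P, hP⟩ := f
  exact ⟨P.caretReplace.toT, P, hP, P.caretReplace.represents_toT⟩

theorem compatible_of_represents {n : ℕ} [n.AtLeastTwo] {P : TreePair n}
    {f F : UnitAddCircle ≃ₜ UnitAddCircle} (hf : P.Represents f)
    (hF : P.caretReplace.Represents F) : Compatible n f F := by
  refine ⟨P.pairs, P.isPairing, hf, ?_⟩
  rw [← P.pairs_caretReplace]
  exact hF

theorem compatible_phi {n : ℕ} [n.AtLeastTwo] (f : T n) :
    Compatible n f ((exists_phi f).choose : UnitAddCircle ≃ₜ UnitAddCircle) :=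
  compatible_of_represents (exists_phi f).choose_spec.choose_spec.1
    (exists_phi f).choose_spec.choose_spec.2

/-- The homomorphism `φ_* : T_n → T_2` induced by the caret replacement: it sends the element
represented by a labelled `n`-ary tree pair to the element represented by the caret replacement
of this tree pair. -/
noncomputable def phi (n : ℕ) [n.AtLeastTwo] : T n →* T 2 where
  toFun f := (exists_phi f).choose
  map_one' := Subtype.ext ((compatible_phi 1).unique (Compatible.one n))
  map_mul' f g := Subtype.ext
    ((compatible_phi (f * g)).unique ((compatible_phi f).mul (compatible_phi g)))

theorem phi_toT {n : ℕ} [n.AtLeastTwo] (P : TreePair n) : phi n P.toT = P.caretReplace.toT :=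
  Subtype.ext ((compatible_phi P.toT).unique
    (compatible_of_represents P.represents_toT P.caretReplace.represents_toT))

/-! ### The generators and the word metric -/

/-- The tree pairs of the generators `x_0, …, x_{n-1}`. For `i ≤ n - 2` the trees have two carets,
and the lower caret hangs from the `i`-th leaf of the upper one in the source tree and from the
last leaf in the target tree; `x_{n-1}` is the copy of `x_0` below the last leaf of a caret.
Leaves are labelled from the left to the right. For `n = 2`, these are the inverses of
the standard generators `A` and `B` of `F`. -/
def xPair (n : ℕ) [n.AtLeastTwo] (i : Fin n) : TreePair n :=
  if (i : ℕ) < n - 1 then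
    { source := ⟨NTree.twoCarets n i, 0⟩
      target := ⟨NTree.twoCarets n (n - 1), 0⟩
      numLeaves_eq := by
        rw [NTree.numLeaves_twoCarets i.2,
          NTree.numLeaves_twoCarets (Nat.sub_lt (NeZero.pos n) one_pos)] }
  else
    { source := ⟨NTree.underLast n (NTree.twoCarets n 0), 0⟩
      target := ⟨NTree.underLast n (NTree.twoCarets n (n - 1)), 0⟩
      numLeaves_eq := by
        rw [NTree.numLeaves_underLast, NTree.numLeaves_underLast,
          NTree.numLeaves_twoCarets (NeZero.pos n),
          NTree.numLeaves_twoCarets (Nat.sub_lt (NeZero.pos n) one_pos)] }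

/-- The tree pair of the torsion element `c_0`: both trees are a single caret, and the labels of
the target tree are those of the source tree shifted to the left by one. -/
def cPair (n : ℕ) : TreePair n where
  source := ⟨NTree.caret n, 0⟩
  target := ⟨NTree.caret n, n - 1⟩
  numLeaves_eq := rfl

/-- The finite set `{x_0, …, x_{n-1}, c_0}`. -/
def gens (n : ℕ) [n.AtLeastTwo] : Set (T n) :=
  insert (cPair n).toT (Set.range fun i : Fin n => (xPair n i).toT)

/-- The word length of `g` with respect to `S`: the least length of a word in the letters `s` and
`s⁻¹` (`s ∈ S`) whose value is `g`. It is only meaningful if `S` generates the group. -/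
noncomputable def wordLength {G : Type*} [Group G] (S : Set G) (g : G) : ℕ :=
  sInf {k | ∃ l : List G, (∀ s ∈ l, s ∈ S ∨ s⁻¹ ∈ S) ∧ l.prod = g ∧ l.length = k}

/-- The word metric of a group with respect to a generating set. -/
noncomputable def wordDist {G : Type*} [Group G] (S : Set G) (g h : G) : ℕ :=
  wordLength S (g⁻¹ * h)

end Thompson

/-!
The word length of an element of `T n` agrees, up to a multiplicative constant which does not
depend on `n` and an additive one, with the number of carets of its reduced tree pair, and this
number changes by a factor between `1` and `n - 1` under the caret replacement.

*Carets of the reduced tree pair.* An `n`-adic interval is a break of `f` if `f` does not map it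
affinely onto an `n`-adic interval, and the complexity of `f` is the number of its breaks. Breaks
are inner vertices of the source tree of every tree pair for `f` (`breaks_subset_inner`). If an
inner vertex is not a break, then a caret can be removed from both trees (`exists_shorter`), so a
smallest tree pair has exactly `complexity f` carets. Working with breaks avoids the uniqueness of
reduced tree pairs, and makes the complexity visibly subadditive (`complexity_mul_le`). As
generators have at most three carets, the complexity is at most three times the word length.

*The upper bound for the word length* (`wordLE_of_represents`). An element with `N` carets is a
product of three factors: the map which straightens the source tree to the all-right tree with `N`
carets, a rotation of the all-right tree, and the inverse of the map which straightens the target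
tree. A tree is straightened caret by caret, from the left to the right; each step is a conjugate
of a generator by a power of `x_0`, and the exponents of these powers are monotone, so they
telescope to at most `2 * N` letters besides the `N` generators (`exists_unfolds`). A rotation by
`l + q * (n - 1)` places with `0 < l < n` arises from `c_0 ^ l` by adding carets in pairs of
corresponding places: `q` times below the first leaf and its image, which increases the number of
places by `n - 1`, and then below the leaf which is taken to the first one, which does not change
it (`exists_rotates`). Up to powers of `x_0` which telescope, each step costs at most two letters.
The result is a word with at most `8 * N + n` letters, which also shows that the generators
generate.

*Caret replacement.* It multiplies the number of carets of a tree by `n - 1`, whence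
`complexity_phi_le`. In the other direction, the replacement of a break of `f` is a break of `phi
n f` (`code_mem_breaks_phi`). Indeed, if `phi n f` maps the replacement of the vertex `w` to the
binary vertex `v`, then it maps the vertex obtained from `w` by going right several times to a
descendant of `v` which is the replacement of an `n`-ary vertex; as only the last leaf of an
all-right tree is a right child, `v` is itself the replacement of an `n`-ary vertex, and `f` maps
`w` to it.
-/

namespace Thompson

/-! ### Words in a generating set -/

section

variable {G : Type*} [Group G] {S : Set G}

/-- `g` is the value of a word with at most `k` letters from `S` and its inverses. -/
def WordLE (S : Set G) (k : ℕ) (g : G) : Prop :=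
  ∃ l : List G, (∀ s ∈ l, s ∈ S ∨ s⁻¹ ∈ S) ∧ l.prod = g ∧ l.length ≤ k

theorem WordLE.mono {k k' : ℕ} {g : G} (h : WordLE S k g) (hk : k ≤ k') : WordLE S k' g := by
  obtain ⟨l, h1, h2, h3⟩ := h
  exact ⟨l, h1, h2, h3.trans hk⟩

theorem WordLE.one (k : ℕ) : WordLE S k (1 : G) := ⟨[], by simp, by simp, by simp⟩

theorem WordLE.of_mem {g : G} (h : g ∈ S) : WordLE S 1 g :=
  ⟨[g], by simp [h], by simp, by simp⟩

theorem WordLE.mul {k k' : ℕ} {g g' : G} (h : WordLE S k g) (h' : WordLE S k' g') :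
    WordLE S (k + k') (g * g') := by
  obtain ⟨l, h1, h2, h3⟩ := h
  obtain ⟨l', h1', h2', h3'⟩ := h'
  refine ⟨l ++ l', ?_, by simp [h2, h2'], by simp; omega⟩
  intro s hs
  rcases List.mem_append.1 hs with hs | hs
  · exact h1 s hs
  · exact h1' s hs

theorem WordLE.inv {k : ℕ} {g : G} (h : WordLE S k g) : WordLE S k g⁻¹ := by
  obtain ⟨l, h1, rfl, h3⟩ := h
  refine ⟨(l.map fun s => s⁻¹).reverse, ?_, (List.prod_inv_reverse l).symm, by simpa using h3⟩
  intro s hs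
  simp only [List.mem_reverse, List.mem_map] at hs
  obtain ⟨a, ha, rfl⟩ := hs
  rw [inv_inv]
  exact (h1 a ha).symm

theorem WordLE.mem_closure {k : ℕ} {g : G} (h : WordLE S k g) : g ∈ Subgroup.closure S := by
  obtain ⟨l, h1, rfl, -⟩ := h
  refine list_prod_mem fun s hs => ?_
  rcases h1 s hs with h | h
  · exact Subgroup.subset_closure h
  · exact inv_mem_iff.1 (Subgroup.subset_closure h)

theorem WordLE.wordLength_le {k : ℕ} {g : G} (h : WordLE S k g) : wordLength S g ≤ k := by
  obtain ⟨l, h1, h2, h3⟩ := h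
  exact (Nat.sInf_le (s := {k | ∃ l : List G, (∀ s ∈ l, s ∈ S ∨ s⁻¹ ∈ S) ∧ l.prod = g ∧
    l.length = k}) ⟨l, h1, h2, rfl⟩).trans h3

/-- The infimum in the definition of the word length is attained at every value of a word. -/
theorem WordLE.exists_word {k : ℕ} {g : G} (h : WordLE S k g) :
    ∃ l : List G, (∀ s ∈ l, s ∈ S ∨ s⁻¹ ∈ S) ∧ l.prod = g ∧ l.length = wordLength S g := by
  obtain ⟨l, h1, h2, -⟩ := h
  exact Nat.sInf_mem (s := {k | ∃ l : List G, (∀ s ∈ l, s ∈ S ∨ s⁻¹ ∈ S) ∧ l.prod = g ∧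
    l.length = k}) ⟨_, l, h1, h2, rfl⟩

end

/-! ### Affine maps between intervals -/

section

variable {n : ℕ} [n.AtLeastTwo]

/-- `f` maps the interval with address `a` onto the interval with address `b` by the increasing
affine bijection. -/
def Maps (f : T n) (a b : List (Fin n)) : Prop :=
  ∀ t ∈ Set.Icc (0 : ℝ) 1, (f : UnitAddCircle ≃ₜ UnitAddCircle) (point a t) = point b t

theorem Maps.append {f : T n} {a b : List (Fin n)} (h : Maps f a b) (s : List (Fin n)) :
    Maps f (a ++ s) (b ++ s) := by
  intro t ht
  rw [point_append, point_append]
  exact h _ (sub_mem s ht)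

theorem Maps.mul {f g : T n} {a b c : List (Fin n)} (hg : Maps g b c) (hf : Maps f a b) :
    Maps (g * f) a c := by
  intro t ht
  rw [Subgroup.coe_mul, mul_apply', hf t ht, hg t ht]

theorem Maps.inv {f : T n} {a b : List (Fin n)} (h : Maps f a b) : Maps f⁻¹ b a := by
  intro t ht
  rw [← h t ht, ← mul_apply', ← Subgroup.coe_mul, inv_mul_cancel]
  rfl

theorem Maps.one (a : List (Fin n)) : Maps (1 : T n) a a := fun _ _ => rfl

theorem Maps.right_unique {f : T n} {a b c : List (Fin n)} (h : Maps f a b) (h' : Maps f a c) :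
    b = c :=
  point_injective fun t ht => (h t ht).symm.trans (h' t ht)

theorem TreePair.maps_toT (P : TreePair n) {p : List (Fin n) × List (Fin n)} (hp : p ∈ P.pairs) :
    Maps P.toT p.1 p.2 := P.represents_toT p hp

theorem TreePair.Represents.eq_of_maps {P : TreePair n} {f g : T n}
    (hf : P.Represents (f : UnitAddCircle ≃ₜ UnitAddCircle))
    (hg : ∀ p ∈ P.pairs, Maps g p.1 p.2) : f = g :=
  Subtype.ext (DFunLike.coe_injective (Rep.ext P.isPairing hf hg))

end

/-! ### Counting carets and leaves -/

/-- The number of carets. -/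
def NTree.carets {n : ℕ} : NTree n → ℕ
  | leaf => 0
  | node c => 1 + ∑ j, carets (c j)

theorem NTree.numLeaves_eq_carets {n : ℕ} [NeZero n] (U : NTree n) :
    U.numLeaves = U.carets * (n - 1) + 1 := by
  induction U with
  | leaf => simp [carets, numLeaves, leaves]
  | node c ih =>
    rw [numLeaves_node, carets, Finset.sum_congr rfl fun j _ => ih j, Finset.sum_add_distrib,
      ← Finset.sum_mul, add_mul]
    have := NeZero.pos n
    simp only [Finset.sum_const, Finset.card_univ, Fintype.card_fin, smul_eq_mul]
    omega

theorem NTree.carets_caret (n : ℕ) : (caret n).carets = 1 := by simp [caret, carets]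

theorem getElem?_flatMap_iff {α β : Type*} (f : α → List β) (l : List α) : ∀ (k : ℕ) (x : β),
    (l.flatMap f)[k]? = some x ↔ ∃ j k' a, l[j]? = some a ∧ (f a)[k']? = some x ∧
      k = ((l.take j).map fun a => (f a).length).sum + k' := by
  induction l with
  | nil => simp
  | cons a l ih =>
    intro k x
    rw [List.flatMap_cons]
    constructor
    · intro h
      by_cases hk : k < (f a).length
      · rw [List.getElem?_append_left hk] at h
        exact ⟨0, k, a, by simp, h, by simp⟩
      · rw [List.getElem?_append_right (by omega), ih] at h
        obtain ⟨j, k', b, h1, h2, h3⟩ := h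
        exact ⟨j + 1, k', b, by simpa using h1, h2, by
          rw [List.take_succ_cons, List.map_cons, List.sum_cons]; omega⟩
    · rintro ⟨j, k', b, h1, h2, h3⟩
      cases j with
      | zero =>
        obtain rfl : a = b := by simpa using h1
        have : k = k' := by simpa using h3
        subst this
        rw [List.getElem?_append_left (List.getElem?_eq_some_iff.1 h2).1, h2]
      | succ j =>
        simp only [List.take_succ_cons, List.map_cons, List.sum_cons] at h3
        rw [List.getElem?_append_right (by omega), ih]
        exact ⟨j, k', b, by simpa using h1, h2, by omega⟩

/-- The position of a leaf of `node c` in terms of its position in the subtree to which it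
belongs. -/
theorem NTree.getElem?_leaves_node {n : ℕ} (c : Fin n → NTree n) (k : ℕ) (w : List (Fin n)) :
    (node c).leaves[k]? = some w ↔ ∃ (j : Fin n) (k' : ℕ) (w' : List (Fin n)), w = j :: w' ∧
      (c j).leaves[k']? = some w' ∧
      k = (((List.finRange n).take j).map fun i => (c i).numLeaves).sum + k' := by
  rw [leaves, getElem?_flatMap_iff]
  simp only [List.length_map, List.getElem?_map, Option.map_eq_some_iff]
  constructor
  · rintro ⟨i, k', j, h1, ⟨w', h2, rfl⟩, h3⟩
    obtain ⟨hi, h1⟩ := List.getElem?_eq_some_iff.1 h1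
    obtain rfl : (j : ℕ) = i := by rw [← h1]; simp
    exact ⟨j, k', w', rfl, h2, h3⟩
  · rintro ⟨j, k', w', rfl, h2, h3⟩
    exact ⟨j, k', j, by simp, ⟨w', h2, rfl⟩, h3⟩

theorem NTree.sum_take_numLeaves_leaf {n j : ℕ} (hj : j ≤ n) :
    (((List.finRange n).take j).map fun _ => (leaf : NTree n).numLeaves).sum = j := by
  simp [numLeaves, leaves, hj]

theorem NTree.getElem?_leaves_caret {n : ℕ} (k : ℕ) (w : List (Fin n)) :
    (caret n).leaves[k]? = some w ↔ ∃ j : Fin n, w = [j] ∧ k = j := by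
  rw [caret, getElem?_leaves_node]
  constructor
  · rintro ⟨j, k', w', rfl, h2, rfl⟩
    rw [sum_take_numLeaves_leaf j.2.le]
    simp only [leaves, List.getElem?_singleton] at h2
    split_ifs at h2 with hk
    obtain rfl : [] = w' := by simpa using h2
    exact ⟨j, rfl, by omega⟩
  · rintro ⟨j, rfl, rfl⟩
    exact ⟨j, 0, [], rfl, by simp [leaves], by rw [sum_take_numLeaves_leaf j.2.le]; rfl⟩

theorem NTree.sum_take_numLeaves_ite {n i : ℕ} (s : NTree n) {j : ℕ} (hj : j ≤ n) :
    (((List.finRange n).take j).map fun a : Fin n =>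
      (if (a : ℕ) = i then s else leaf).numLeaves).sum =
      if j ≤ i then j else j - 1 + s.numLeaves := by
  induction j with
  | zero => simp
  | succ j ih =>
    have e : (List.finRange n)[j]? = some (⟨j, hj⟩ : Fin n) := by
      simp [List.getElem?_eq_some_iff]; omega
    rw [List.take_add_one, e, List.map_append, List.sum_append, ih (by omega)]
    simp only [Option.toList_some, List.map_cons, List.map_nil, List.sum_cons, List.sum_nil,
      add_zero]
    rcases lt_trichotomy j i with h | h | h
    · rw [if_pos h.le, if_neg h.ne, if_pos (show j + 1 ≤ i by omega)]
      simp [numLeaves, leaves]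
    · rw [if_pos h.le, if_pos h, if_neg (by omega)]
      rfl
    · rw [if_neg (by omega), if_neg h.ne', if_neg (by omega)]
      simp only [numLeaves, leaves, List.length_singleton]
      omega

section

variable {n : ℕ} [n.AtLeastTwo]

/-! ### Leaves of the all-right tree -/

theorem two_le (n : ℕ) [n.AtLeastTwo] : 2 ≤ n := Nat.AtLeastTwo.prop

/-- The rightmost direction. -/
def lastDir (n : ℕ) [n.AtLeastTwo] : Fin n := ⟨n - 1, Nat.sub_lt (NeZero.pos n) one_pos⟩

/-- The address of the `k`-th leaf of the all-right `n`-ary tree with `N` carets. It is only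
meaningful for `k ≤ N * (n - 1)`. -/
def combLeaf : ℕ → ℕ → List (Fin n)
  | 0, _ => []
  | N + 1, k => if h : k < n - 1 then [⟨k, h.trans_le (Nat.sub_le n 1)⟩]
      else lastDir n :: combLeaf N (k - (n - 1))

theorem combLeaf_of_lt (N : ℕ) {k : ℕ} (h : k < n - 1) :
    combLeaf (N + 1) k = [(⟨k, h.trans_le (Nat.sub_le n 1)⟩ : Fin n)] := by
  rw [combLeaf, dif_pos h]

theorem combLeaf_of_le (N : ℕ) {k : ℕ} (h : n - 1 ≤ k) :
    combLeaf (n := n) (N + 1) k = lastDir n :: combLeaf N (k - (n - 1)) := by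
  rw [combLeaf, dif_neg (by omega)]

theorem combLeaf_succ {N : ℕ} : ∀ {k : ℕ}, k < N * (n - 1) →
    combLeaf (n := n) (N + 1) k = combLeaf N k := by
  induction N with
  | zero => intro k h; simp at h
  | succ N ih =>
    intro k h
    rw [Nat.succ_mul] at h
    by_cases hk : k < n - 1
    · rw [combLeaf_of_lt _ hk, combLeaf_of_lt _ hk]
    · rw [combLeaf_of_le (k := k) (N + 1) (by omega),
        combLeaf_of_le (k := k) N (by omega), ih (by omega)]

theorem combLeaf_last_append (N : ℕ) (j : Fin n) :
    combLeaf N (N * (n - 1)) ++ [j] = combLeaf (N + 1) (N * (n - 1) + j) := by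
  induction N with
  | zero =>
    by_cases hj : (j : ℕ) < n - 1
    · rw [combLeaf_of_lt _ (by simpa using hj)]
      simp [combLeaf]
    · have : j = lastDir n := Fin.ext (by have := j.2; simp [lastDir]; omega)
      rw [combLeaf_of_le _ (by omega), this]
      simp [combLeaf]
  | succ N ih =>
    rw [Nat.succ_mul, combLeaf_of_le _ (by omega), combLeaf_of_le _ (by omega), List.cons_append,
      Nat.add_sub_cancel, ih]
    congr 2
    omega

/-! ### Splitting one leaf of the all-right tree -/

/-- `f` maps the all-right tree with `N` carets and an additional caret below its `i`-th leaf to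
the all-right tree with `N + 1` carets, preserving the order of the leaves. -/
structure Splits (N i : ℕ) (f : T n) : Prop where
  before : ∀ k < i, Maps f (combLeaf N k) (combLeaf (N + 1) k)
  inside : ∀ j : Fin n, Maps f (combLeaf N i ++ [j]) (combLeaf (N + 1) (i + j))
  after : ∀ k, i < k → k ≤ N * (n - 1) → Maps f (combLeaf N k) (combLeaf (N + 1) (k + (n - 1)))

/-- A caret below the last leaf of an all-right tree yields an all-right tree. -/
theorem splits_one (N : ℕ) : Splits N (N * (n - 1)) (1 : T n) where
  before k hk := by rw [combLeaf_succ hk]; exact Maps.one _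
  inside j := by rw [combLeaf_last_append]; exact Maps.one _
  after k h1 h2 := by omega

/-- The generator `x_i`. -/
noncomputable def xGen (i : Fin n) : T n := (xPair n i).toT

theorem wordLE_xGen (i : Fin n) : WordLE (gens n) 1 (xGen i) :=
  WordLE.of_mem (Set.mem_insert_of_mem _ ⟨i, rfl⟩)

theorem TreePair.exists_getElem?_of_mem_pairs (P : TreePair n)
    {p : List (Fin n) × List (Fin n)} (hp : p ∈ P.pairs) : ∃ k < P.source.tree.numLeaves,
      P.source.tree.leaves[(k + P.source.zero) % P.source.tree.numLeaves]? = some p.1 ∧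
      P.target.tree.leaves[(k + P.target.zero) % P.target.tree.numLeaves]? = some p.2 := by
  obtain ⟨k, hk, rfl⟩ := List.mem_iff_getElem.1 hp
  have hk' : k < P.source.tree.numLeaves := by
    have := congrArg List.length P.map_fst_pairs
    simp only [List.length_map, LabelledTree.labelled, List.length_rotate] at this
    rw [NTree.numLeaves, ← this]
    exact hk
  refine ⟨k, hk', ?_⟩
  simp only [TreePair.pairs, LabelledTree.labelled, List.getElem_zip, List.getElem_rotate]
  exact ⟨List.getElem?_eq_getElem _, List.getElem?_eq_getElem _⟩

theorem TreePair.mem_pairs (P : TreePair n) {k : ℕ} {w v : List (Fin n)}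
    (hw : P.source.labelled[k]? = some w) (hv : P.target.labelled[k]? = some v) :
    (w, v) ∈ P.pairs := by
  refine List.mem_iff_getElem?.2 ⟨k, ?_⟩
  rw [TreePair.pairs, List.getElem?_zip_eq_some]
  exact ⟨hw, hv⟩

theorem getElem?_leaves_graft_left {i j : Fin n} (s : NTree n) (h : j < i) :
    (NTree.node fun a : Fin n => if (a : ℕ) = i then s else NTree.leaf).leaves[(j : ℕ)]? =
      some [j] := by
  refine (NTree.getElem?_leaves_node _ _ _).2 ⟨j, 0, [], rfl, ?_, ?_⟩
  · rw [if_neg (Fin.val_ne_of_ne h.ne)]; rfl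
  · rw [NTree.sum_take_numLeaves_ite s j.2.le, if_pos (show (j : ℕ) ≤ i from h.le)]
    rfl

theorem getElem?_leaves_graft_mid (i : Fin n) {s : NTree n} {k : ℕ} {w : List (Fin n)}
    (h : s.leaves[k]? = some w) :
    (NTree.node fun a : Fin n => if (a : ℕ) = i then s else NTree.leaf).leaves[(i : ℕ) + k]? =
      some (i :: w) := by
  refine (NTree.getElem?_leaves_node _ _ _).2 ⟨i, k, w, rfl, ?_, ?_⟩
  · rw [if_pos rfl, h]
  · rw [NTree.sum_take_numLeaves_ite s i.2.le, if_pos le_rfl]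

theorem getElem?_leaves_graft_right {i j : Fin n} (s : NTree n) (h : i < j) :
    (NTree.node fun a : Fin n => if (a : ℕ) = i then s else NTree.leaf).leaves[
      (j : ℕ) - 1 + s.numLeaves]? = some [j] := by
  refine (NTree.getElem?_leaves_node _ _ _).2 ⟨j, 0, [], rfl, ?_, ?_⟩
  · rw [if_neg (Fin.val_ne_of_ne h.ne')]; rfl
  · rw [NTree.sum_take_numLeaves_ite s j.2.le, if_neg (not_le.2 (show (i : ℕ) < j from h))]
    rfl

theorem numLeaves_caret (n : ℕ) [NeZero n] : (NTree.caret n).numLeaves = n := by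
  rw [NTree.numLeaves_eq_carets, NTree.carets_caret]
  have := NeZero.pos n
  omega

/-- The second all-right tree, as the target of the generators. -/
theorem getElem?_leaves_twoCarets_last {k : ℕ} (hk : k ≤ 2 * (n - 1)) :
    (NTree.twoCarets n (n - 1)).leaves[k]? = some (combLeaf 2 k) := by
  have h2 := two_le n
  by_cases h : k < n - 1
  · rw [combLeaf_of_lt _ h]
    exact getElem?_leaves_graft_left (i := lastDir n) (j := ⟨k, by omega⟩) _ h
  · rw [combLeaf_of_le _ (by omega)]
    have := getElem?_leaves_graft_mid (lastDir n) (s := NTree.caret n) (k := k - (n - 1))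
      (w := combLeaf 1 (k - (n - 1))) (by
        rw [NTree.getElem?_leaves_caret]
        refine ⟨⟨k - (n - 1), by omega⟩, ?_, rfl⟩
        have := combLeaf_last_append 0 (⟨k - (n - 1), by omega⟩ : Fin n)
        simpa [combLeaf] using this.symm)
    have e : (lastDir n : ℕ) + (k - (n - 1)) = k := by simp only [lastDir]; omega
    rw [e] at this
    exact this

/-- A homeomorphism which acts below the vertex `p` as `x_i`, `i ≤ n - 2`, splits the `i`-th leaf
of an all-right tree hanging from `p`. -/
theorem maps_of_twoCarets {f : T n} {p : List (Fin n)} {i : Fin n} (hi : (i : ℕ) < n - 1)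
    (h : ∀ (k : ℕ) (w v : List (Fin n)), (NTree.twoCarets n i).leaves[k]? = some w →
      (NTree.twoCarets n (n - 1)).leaves[k]? = some v → Maps f (p ++ w) (p ++ v)) (N : ℕ) :
    (∀ k < (i : ℕ), Maps f (p ++ combLeaf (N + 1) k) (p ++ combLeaf (N + 2) k)) ∧
    (∀ j : Fin n, Maps f (p ++ (combLeaf (N + 1) i ++ [j])) (p ++ combLeaf (N + 2) (i + j))) ∧
    (∀ k, (i : ℕ) < k → k ≤ (N + 1) * (n - 1) →
      Maps f (p ++ combLeaf (N + 1) k) (p ++ combLeaf (N + 2) (k + (n - 1)))) := by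
  have h2 := two_le n
  -- below `2 * (n - 1)` the leaves of the all-right trees with at least two carets coincide
  have comb2 : ∀ k < 2 * (n - 1), combLeaf (n := n) 2 k = combLeaf (N + 2) k := by
    intro k hk
    by_cases h : k < n - 1
    · rw [combLeaf_of_lt _ h, combLeaf_of_lt _ h]
    · rw [combLeaf_of_le (k := k) 1 (by omega), combLeaf_of_le (k := k) (N + 1) (by omega),
        combLeaf_of_lt _ (by omega),
        combLeaf_of_lt _ (by omega)]
  refine ⟨fun k hk => ?_, fun j => ?_, fun k hk hkN => ?_⟩
  · rw [← comb2 k (by omega), combLeaf_of_lt _ (by omega)]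
    exact h k _ _ (getElem?_leaves_graft_left (j := ⟨k, by omega⟩) _ hk)
      (getElem?_leaves_twoCarets_last (by omega))
  · have hj := j.2
    rw [← comb2 _ (by omega), combLeaf_of_lt _ hi]
    exact h _ _ _ (getElem?_leaves_graft_mid i ((NTree.getElem?_leaves_caret _ _).2 ⟨j, rfl, rfl⟩))
      (getElem?_leaves_twoCarets_last (by omega))
  · by_cases hk' : k < n - 1
    · rw [← comb2 _ (by omega), combLeaf_of_lt _ hk']
      have h1 := getElem?_leaves_graft_right (i := i) (j := ⟨k, by omega⟩) (NTree.caret n) hk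
      rw [numLeaves_caret, show k - 1 + n = k + (n - 1) by omega] at h1
      exact h _ _ _ h1 (getElem?_leaves_twoCarets_last (by omega))
    · have h1 := getElem?_leaves_graft_right (i := i) (j := lastDir n) (NTree.caret n) hi
      rw [numLeaves_caret, show ((lastDir n : Fin n) : ℕ) - 1 + n = 2 * (n - 1) by
        simp only [lastDir]; omega] at h1
      have h3 := h _ _ _ h1 (getElem?_leaves_twoCarets_last le_rfl)
      have h4 := h3.append (combLeaf N (k - (n - 1)))
      rw [combLeaf_of_le _ (by omega), combLeaf_of_le _ (by omega), Nat.add_sub_cancel,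
        combLeaf_of_le N (by omega)]
      rw [combLeaf_of_le _ (by omega), combLeaf_of_le _ (by omega)] at h4
      simpa [combLeaf] using h4

theorem splits_xGen_of_lt {i : Fin n} (hi : (i : ℕ) < n - 1) (N : ℕ) :
    Splits (N + 1) i (xGen i) := by
  have e : xPair n i = _ := if_pos hi
  obtain ⟨h1, h2, h3⟩ := maps_of_twoCarets (f := xGen i) (p := []) hi (by
    intro k w v hw hv
    refine TreePair.maps_toT (p := (w, v)) _ (TreePair.mem_pairs (k := k) _ ?_ ?_)
    · rw [e]; simpa [LabelledTree.labelled] using hw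
    · rw [e]; simpa [LabelledTree.labelled] using hv) N
  exact ⟨h1, h2, h3⟩

theorem splits_xGen_last (N : ℕ) : Splits (N + 2) (n - 1) (xGen (lastDir n)) := by
  have hn := two_le n
  have e : xPair n (lastDir n) = _ := if_neg (lt_irrefl (n - 1))
  have hmaps : ∀ (k : ℕ) (w v : List (Fin n)),
      (NTree.underLast n (NTree.twoCarets n 0)).leaves[k]? = some w →
      (NTree.underLast n (NTree.twoCarets n (n - 1))).leaves[k]? = some v →
      Maps (xGen (lastDir n)) w v := by
    intro k w v hw hv
    refine TreePair.maps_toT (p := (w, v)) _ (TreePair.mem_pairs (k := k) _ ?_ ?_)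
    · rw [e]; simpa [LabelledTree.labelled] using hw
    · rw [e]; simpa [LabelledTree.labelled] using hv
  obtain ⟨-, h2, h3⟩ := maps_of_twoCarets (f := xGen (lastDir n)) (p := [lastDir n])
    (i := ⟨0, by omega⟩) (show 0 < n - 1 by omega) (fun k w v hw hv =>
      hmaps _ _ _ (getElem?_leaves_graft_mid (lastDir n) hw)
        (getElem?_leaves_graft_mid (lastDir n) hv)) N
  refine ⟨fun k hk => ?_, fun j => ?_, fun k hk hkN => ?_⟩
  · rw [combLeaf_of_lt _ hk, combLeaf_of_lt _ hk]
    exact hmaps _ _ _ (getElem?_leaves_graft_left (i := lastDir n) (j := ⟨k, by omega⟩) _ hk)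
      (getElem?_leaves_graft_left (i := lastDir n) (j := ⟨k, by omega⟩) _ hk)
  · rw [combLeaf_of_le _ le_rfl, combLeaf_of_le (k := n - 1 + j) _ (by omega), Nat.sub_self,
      Nat.add_sub_cancel_left]
    simpa using h2 j
  · rw [show (N + 2) * (n - 1) = (N + 1) * (n - 1) + (n - 1) by ring] at hkN
    rw [combLeaf_of_le _ hk.le, combLeaf_of_le (k := k + (n - 1)) _ (by omega),
      show k + (n - 1) - (n - 1) = k - (n - 1) + (n - 1) by omega]
    exact h3 _ (show 0 < k - (n - 1) by omega) (by omega)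

/-- The generator `x_0`, conjugation with which shifts the all-right tree by one caret. -/
noncomputable def shift (n : ℕ) [n.AtLeastTwo] : T n :=
  xGen ⟨0, NeZero.pos n⟩

theorem splits_shift (N : ℕ) : Splits (N + 1) 0 (shift n) :=
  splits_xGen_of_lt (i := ⟨0, NeZero.pos n⟩) (by have := two_le n; simp only; omega) N

theorem wordLE_shift : WordLE (gens n) 1 (shift n) := wordLE_xGen _

theorem wordLE_shift_pow (k : ℕ) : WordLE (gens n) k (shift n ^ k) := by
  induction k with
  | zero => exact WordLE.one _
  | succ k ih => rw [pow_succ]; exact ih.mul wordLE_shift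

/-- Conjugation with `x_0` moves the place of the split by one caret to the right. -/
theorem Splits.conj {N i : ℕ} {g : T n} (hg : Splits (N + 1) i g) (h0 : 0 < i)
    (hi : i ≤ (N + 1) * (n - 1)) :
    Splits (N + 2) (i + (n - 1)) (shift n * g * (shift n)⁻¹) := by
  have s1 := splits_shift (n := n) N
  have s2 := splits_shift (n := n) (N + 1)
  have e : (N + 1 + 1) * (n - 1) = (N + 1) * (n - 1) + (n - 1) := by ring
  have hn := two_le n
  refine ⟨fun k hk => ?_, fun j => ?_, fun k hk hkN => ?_⟩
  · by_cases h : k < n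
    · have h1 := s1.inside ⟨k, h⟩
      have h2 := s2.inside ⟨k, h⟩
      simp only [zero_add] at h1 h2
      exact (h2.mul ((hg.before 0 h0).append [⟨k, h⟩])).mul h1.inv
    · have h1 := s1.after (k - (n - 1)) (by omega) (by omega)
      have h2 := s2.after (k - (n - 1)) (by omega) (by omega)
      rw [show k - (n - 1) + (n - 1) = k by omega] at h1 h2
      exact (h2.mul (hg.before _ (by omega))).mul h1.inv
  · have hj := j.2
    have h1 := s1.after i h0 hi
    have h2 := s2.after (i + j) (by omega) (by omega)
    rw [show i + j + (n - 1) = i + (n - 1) + j by omega] at h2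
    exact (h2.mul (hg.inside j)).mul (h1.inv.append [j])
  · rw [show (N + 2) * (n - 1) = (N + 1) * (n - 1) + (n - 1) by ring] at hkN
    have h1 := s1.after (k - (n - 1)) (by omega) (by omega)
    have h2 := s2.after k (by omega) (by omega)
    have h3 := hg.after (k - (n - 1)) (by omega) (by omega)
    rw [show k - (n - 1) + (n - 1) = k by omega] at h1 h3
    exact (h2.mul h3).mul h1.inv

/-- The number of shifts which bring the `i`-th leaf of the all-right tree to one of the leaves
`1, …, n - 1`, on which a generator acts (and `0` for the leaf `0`). -/
def level (n i : ℕ) : ℕ := (i - 1) / (n - 1)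

theorem level_add {i : ℕ} (hi : 0 < i) : level n (i + (n - 1)) = level n i + 1 := by
  have := two_le n
  rw [level, level, show i + (n - 1) - 1 = i - 1 + (n - 1) by omega,
    Nat.add_div_right _ (by omega)]

theorem level_eq_zero {i : ℕ} (hi : i < n) : level n i = 0 := by
  have := two_le n
  exact Nat.div_eq_of_lt (by omega)

theorem level_mono {i j : ℕ} (h : i ≤ j) : level n i ≤ level n j :=
  Nat.div_le_div_right (Nat.sub_le_sub_right h 1)

/-- Every leaf of an all-right tree can be split by a conjugate of a generator by a power of `x_0`
(or by the identity, for the last leaf). -/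
theorem exists_splits (N : ℕ) : ∀ i ≤ N * (n - 1), ∃ g : T n, Splits N i g ∧
    WordLE (gens n) 1 ((shift n ^ level n i)⁻¹ * g * shift n ^ level n i) := by
  have hn := two_le n
  induction N with
  | zero =>
    intro i hi
    obtain rfl : i = 0 * (n - 1) := by simpa using hi
    exact ⟨1, splits_one _, by simpa using WordLE.one 1⟩
  | succ N ih =>
    intro i hi
    rcases hi.eq_or_lt with rfl | hi
    · exact ⟨1, splits_one _, by simpa using WordLE.one 1⟩
    rw [Nat.succ_mul] at hi
    by_cases hin : i < n
    · refine ⟨xGen ⟨i, hin⟩, ?_, ?_⟩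
      · by_cases h : i < n - 1
        · exact splits_xGen_of_lt (i := ⟨i, hin⟩) h N
        · obtain rfl : i = n - 1 := by omega
          cases N with
          | zero => omega
          | succ N => exact splits_xGen_last N
      · rw [level_eq_zero hin]
        simpa using wordLE_xGen _
    · obtain ⟨g, h1, h2⟩ := ih (i - (n - 1)) (by omega)
      cases N with
      | zero => omega
      | succ N =>
        have h3 := h1.conj (by omega) (by omega)
        have h4 := level_add (n := n) (i := i - (n - 1)) (by omega)
        rw [show i - (n - 1) + (n - 1) = i by omega] at h3 h4
        refine ⟨_, h3, ?_⟩
        rw [h4]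
        convert h2 using 1
        rw [pow_succ']
        group

end

section

variable {n : ℕ} [n.AtLeastTwo]

/-! ### Straightening a tree -/

/-- `f` maps the tree which is obtained from the all-right tree with `N` carets by hanging the
trees `ts` from consecutive leaves, the first of which is the `i`-th one, to an all-right tree,
preserving the order of the leaves. -/
structure Unfolds (N i : ℕ) (ts : List (NTree n)) (f : T n) : Prop where
  before : ∀ k < i, Maps f (combLeaf N k) (combLeaf (N + (ts.map NTree.carets).sum) k)
  inside : ∀ (j : ℕ) (s : NTree n), ts[j]? = some s → ∀ (k : ℕ) (w : List (Fin n)),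
    s.leaves[k]? = some w → Maps f (combLeaf N (i + j) ++ w)
      (combLeaf (N + (ts.map NTree.carets).sum) (i + ((ts.take j).map NTree.numLeaves).sum + k))
  after : ∀ k, i + ts.length ≤ k → k ≤ N * (n - 1) → Maps f (combLeaf N k)
    (combLeaf (N + (ts.map NTree.carets).sum) (k + (ts.map NTree.carets).sum * (n - 1)))

theorem unfolds_nil (N i : ℕ) : Unfolds N i [] (1 : T n) where
  before k _ := by simpa using Maps.one _
  inside j s h := by simp at h
  after k _ _ := by simpa using Maps.one _

theorem Unfolds.cons {N i : ℕ} {s : NTree n} {ts : List (NTree n)} {f g : T n}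
    (hf : Unfolds N i [s] f) (hg : Unfolds (N + s.carets) (i + s.numLeaves) ts g)
    (hi : i + (ts.length + 1) ≤ N * (n - 1) + 1) : Unfolds N i (s :: ts) (g * f) := by
  obtain ⟨f1, f2, f3⟩ := hf
  obtain ⟨g1, g2, g3⟩ := hg
  simp only [List.map_cons, List.map_nil, List.sum_cons, List.sum_nil, add_zero,
    List.length_singleton] at f1 f2 f3
  have hs := s.numLeaves_eq_carets
  refine ⟨fun k hk => ?_, fun j t hj k w hw => ?_, fun k hk hkN => ?_⟩
  · rw [List.map_cons, List.sum_cons, ← add_assoc]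
    exact (g1 k (by omega)).mul (f1 k hk)
  · rw [List.map_cons, List.sum_cons, ← add_assoc]
    cases j with
    | zero =>
      obtain rfl : s = t := by simpa using hj
      have h1 := f2 0 s rfl k w hw
      simp only [List.take_zero, List.map_nil, List.sum_nil, add_zero] at h1 ⊢
      have hk : k < s.numLeaves := (List.getElem?_eq_some_iff.1 hw).1
      exact (g1 (i + k) (by omega)).mul h1
    | succ j =>
      rw [List.getElem?_cons_succ] at hj
      have hj' : j < ts.length := (List.getElem?_eq_some_iff.1 hj).1
      have h1 := (f3 (i + (j + 1)) (by omega) (by omega)).append w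
      rw [show i + (j + 1) + s.carets * (n - 1) = i + s.numLeaves + j by omega] at h1
      have h2 := g2 j t hj k w hw
      rw [List.take_succ_cons, List.map_cons, List.sum_cons, ← add_assoc i s.numLeaves]
      exact h2.mul h1
  · rw [List.map_cons, List.sum_cons, ← add_assoc, add_mul, ← add_assoc]
    rw [List.length_cons] at hk
    exact (g3 _ (by omega) (by rw [add_mul]; omega)).mul (f3 k (by omega) hkN)

theorem sum_map_carets_finRange (c : Fin n → NTree n) :
    (((List.finRange n).map c).map NTree.carets).sum = ∑ j, (c j).carets := by
  rw [Fin.sum_univ_def, List.map_map]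
  rfl

theorem Unfolds.node {N i : ℕ} {c : Fin n → NTree n} {f h : T n} (hh : Splits N i h)
    (hf : Unfolds (N + 1) i ((List.finRange n).map c) f) :
    Unfolds N i [NTree.node c] (f * h) := by
  have hn := two_le n
  obtain ⟨f1, f2, f3⟩ := hf
  have e : N + ([NTree.node c].map NTree.carets).sum =
      N + 1 + (((List.finRange n).map c).map NTree.carets).sum := by
    rw [sum_map_carets_finRange]
    simp [NTree.carets]
    ring
  have e' : ([NTree.node c].map NTree.carets).sum =
      1 + (((List.finRange n).map c).map NTree.carets).sum := by
    omega
  refine ⟨fun k hk => ?_, fun j s hj k w hw => ?_, fun k hk hkN => ?_⟩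
  · rw [e]
    exact (f1 k hk).mul (hh.before k hk)
  · rw [e]
    have hj0 : j < 1 := (List.getElem?_eq_some_iff.1 hj).1
    obtain rfl : j = 0 := by omega
    obtain rfl : NTree.node c = s := by simpa using hj
    obtain ⟨j, k', w', rfl, hw', rfl⟩ := (NTree.getElem?_leaves_node _ _ _).1 hw
    have h1 := (hh.inside j).append w'
    have h2 := f2 j (c j) (by simp) k' w' hw'
    rw [List.append_assoc, List.singleton_append] at h1
    rw [← List.map_take, List.map_map] at h2
    simpa [Function.comp_def, add_assoc] using h2.mul h1
  · rw [List.length_singleton] at hk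
    rw [e, e', add_mul, one_mul, ← add_assoc]
    refine (f3 _ ?_ ?_).mul (hh.after k (by omega) hkN)
    · rw [List.length_map, List.length_finRange]
      omega
    · rw [Nat.succ_mul]
      omega

/-- The length of the homeomorphism which straightens a tree, up to the shifts which move the
trees to the places where the generators act. The number of these shifts telescopes along
consecutive trees. -/
theorem exists_unfolds_forest (ts : List (NTree n))
    (ih : ∀ s ∈ ts, ∀ N i, i ≤ N * (n - 1) → ∃ f : T n, Unfolds N i [s] f ∧
      WordLE (gens n) (s.carets + (level n (i + s.numLeaves) - level n i))
        ((shift n ^ level n (i + s.numLeaves))⁻¹ * f * shift n ^ level n i)) :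
    ∀ N i, i + ts.length ≤ N * (n - 1) + 1 → ∃ f : T n, Unfolds N i ts f ∧
      WordLE (gens n) ((ts.map NTree.carets).sum +
          (level n (i + (ts.map NTree.numLeaves).sum) - level n i))
        ((shift n ^ level n (i + (ts.map NTree.numLeaves).sum))⁻¹ * f * shift n ^ level n i) := by
  induction ts with
  | nil => intro N i _; exact ⟨1, unfolds_nil N i, by simpa using WordLE.one 0⟩
  | cons s ts iht =>
    intro N i hi
    rw [List.length_cons] at hi
    obtain ⟨f, hf, hf'⟩ := ih s List.mem_cons_self N i (by omega)
    have hs := s.numLeaves_eq_carets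
    obtain ⟨g, hg, hg'⟩ := iht (fun t ht => ih t (List.mem_cons_of_mem _ ht)) (N + s.carets)
      (i + s.numLeaves) (by rw [add_mul]; omega)
    refine ⟨g * f, hf.cons hg hi, ?_⟩
    rw [List.map_cons, List.map_cons, List.sum_cons, List.sum_cons, ← add_assoc i]
    have h1 : level n i ≤ level n (i + s.numLeaves) := level_mono (Nat.le_add_right _ _)
    have h2 : level n (i + s.numLeaves) ≤
      level n (i + s.numLeaves + (ts.map NTree.numLeaves).sum) := level_mono (Nat.le_add_right _ _)
    convert (hg'.mul hf').mono (k' := s.carets + (ts.map NTree.carets).sum +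
      (level n (i + s.numLeaves + (ts.map NTree.numLeaves).sum) - level n i)) (by omega) using 1
    group

theorem exists_unfolds (s : NTree n) : ∀ N i, i ≤ N * (n - 1) → ∃ f : T n, Unfolds N i [s] f ∧
    WordLE (gens n) (s.carets + (level n (i + s.numLeaves) - level n i))
      ((shift n ^ level n (i + s.numLeaves))⁻¹ * f * shift n ^ level n i) := by
  have hn := two_le n
  induction s with
  | leaf =>
    intro N i hi
    refine ⟨1, ⟨fun k _ => by simpa [NTree.carets] using Maps.one _, fun j s hj k w hw => ?_,
      fun k _ _ => by simpa [NTree.carets] using Maps.one _⟩, ?_⟩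
    · have hj0 : j < 1 := (List.getElem?_eq_some_iff.1 hj).1
      obtain rfl : j = 0 := by omega
      obtain rfl : NTree.leaf = s := by simpa using hj
      have hk : k < 1 := (List.getElem?_eq_some_iff.1 hw).1
      obtain rfl : k = 0 := by omega
      obtain rfl : [] = w := by simpa [NTree.leaves] using hw
      simpa [NTree.carets] using Maps.one _
    · have h1 : level n i ≤ level n (i + (NTree.leaf : NTree n).numLeaves) :=
        level_mono (Nat.le_add_right _ _)
      obtain ⟨d, hd⟩ := Nat.exists_eq_add_of_le h1
      rw [hd]
      convert (wordLE_shift_pow (n := n) d).inv using 1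
      · simp [NTree.carets]
      · rw [pow_add]
        group
  | node c ih =>
    intro N i hi
    obtain ⟨h, hh, hh'⟩ := exists_splits N i hi
    obtain ⟨f, hf, hf'⟩ := exists_unfolds_forest ((List.finRange n).map c) (by
      intro s hs
      obtain ⟨j, -, rfl⟩ := List.mem_map.1 hs
      exact ih j) (N + 1) i (by
        rw [List.length_map, List.length_finRange, Nat.succ_mul]
        omega)
    refine ⟨f * h, hf.node hh, ?_⟩
    have e : (((List.finRange n).map c).map NTree.numLeaves).sum = (NTree.node c).numLeaves := by
      rw [NTree.numLeaves_node, Fin.sum_univ_def, List.map_map]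
      rfl
    rw [sum_map_carets_finRange, e] at hf'
    convert (hf'.mul hh') using 1
    · rw [NTree.carets]
      ring
    · group

/-- Every tree is mapped to the all-right tree with the same number of carets, preserving the
order of the leaves, by a word which is at most three times as long as this number. -/
theorem exists_straighten (U : NTree n) : ∃ f : T n, WordLE (gens n) (3 * U.carets) f ∧
    ∀ (k : ℕ) (w : List (Fin n)), U.leaves[k]? = some w → Maps f w (combLeaf U.carets k) := by
  have hn := two_le n
  obtain ⟨f, hf, hf'⟩ := exists_unfolds U 0 0 (Nat.zero_le _)
  refine ⟨f, ?_, fun k w hw => ?_⟩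
  · have e : level n (0 + U.numLeaves) = U.carets := by
      rw [level, NTree.numLeaves_eq_carets, zero_add, Nat.add_sub_cancel]
      exact Nat.mul_div_cancel _ (by omega)
    have e0 : level n 0 = 0 := level_eq_zero (by omega)
    rw [e, e0] at hf'
    convert ((wordLE_shift_pow U.carets).mul hf').mono (k' := 3 * U.carets) (by omega) using 1
    group
  · simpa [combLeaf] using hf.inside 0 U rfl k w hw

/-! ### Rotations of the all-right tree -/

/-- `f` maps the leaves of the all-right tree with `N` carets to the leaves of this tree, and
shifts them cyclically by `l` places to the left. -/
structure Rotates (N l : ℕ) (f : T n) : Prop where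
  lt : ∀ k < l, Maps f (combLeaf N k) (combLeaf N (k + (N * (n - 1) + 1 - l)))
  le : ∀ k, l ≤ k → k ≤ N * (n - 1) → Maps f (combLeaf N k) (combLeaf N (k - l))

/-- Add a caret below the first leaf in the source and below the image of this leaf in the target.
As the first leaf wraps around, the new rotation shifts by `n - 1` more places. -/
theorem Rotates.split_zero {N l : ℕ} {f h g : T n} (hf : Rotates N l f) (hl : 0 < l)
    (hlN : l ≤ N * (n - 1)) (hg : Splits N 0 g) (hh : Splits N (N * (n - 1) + 1 - l) h) :
    Rotates (N + 1) (l + (n - 1)) (h * f * g⁻¹) := by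
  have hn := two_le n
  have e : (N + 1) * (n - 1) = N * (n - 1) + (n - 1) := by ring
  refine ⟨fun k hk => ?_, fun k hk hkN => ?_⟩
  · by_cases hkn : k < n
    · have h1 := hg.inside ⟨k, hkn⟩
      have h2 := hh.inside ⟨k, hkn⟩
      have h3 := (hf.lt 0 hl).append [⟨k, hkn⟩]
      simp only [zero_add] at h1 h3
      rw [e, show k + (N * (n - 1) + (n - 1) + 1 - (l + (n - 1))) = N * (n - 1) + 1 - l + k by
        omega]
      exact (h2.mul h3).mul h1.inv
    · have h1 := hg.after (k - (n - 1)) (by omega) (by omega)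
      have h2 := hh.after (k - (n - 1) + (N * (n - 1) + 1 - l)) (by omega) (by omega)
      have h3 := hf.lt (k - (n - 1)) (by omega)
      rw [show k - (n - 1) + (n - 1) = k by omega] at h1
      rw [show k - (n - 1) + (N * (n - 1) + 1 - l) + (n - 1) =
        k + ((N + 1) * (n - 1) + 1 - (l + (n - 1))) by omega] at h2
      exact (h2.mul h3).mul h1.inv
  · have h1 := hg.after (k - (n - 1)) (by omega) (by omega)
    have h3 := hf.le (k - (n - 1)) (by omega) (by omega)
    have h2 := hh.before (k - (n - 1) - l) (by omega)
    rw [show k - (n - 1) + (n - 1) = k by omega] at h1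
    rw [show k - (n - 1) - l = k - (l + (n - 1)) by omega] at h2 h3
    exact (h2.mul h3).mul h1.inv

/-- Add a caret below the leaf which a rotation takes to the first one, and below the first leaf in
the target. The new rotation shifts by the same number of places. -/
theorem Rotates.split_self {N l : ℕ} {f h g : T n} (hf : Rotates N l f)
    (hlN : l ≤ N * (n - 1)) (hg : Splits N l g) (hh : Splits N 0 h) :
    Rotates (N + 1) l (h * f * g⁻¹) := by
  have hn := two_le n
  have e : (N + 1) * (n - 1) = N * (n - 1) + (n - 1) := by ring
  refine ⟨fun k hk => ?_, fun k hk hkN => ?_⟩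
  · have h1 := hg.before k hk
    have h2 := hh.after (k + (N * (n - 1) + 1 - l)) (by omega) (by omega)
    rw [show k + (N * (n - 1) + 1 - l) + (n - 1) = k + ((N + 1) * (n - 1) + 1 - l) by omega] at h2
    exact (h2.mul (hf.lt k hk)).mul h1.inv
  · by_cases hkn : k - l < n
    · have h1 := hg.inside ⟨k - l, hkn⟩
      have h2 := hh.inside ⟨k - l, hkn⟩
      have h3 := (hf.le l le_rfl hlN).append [⟨k - l, hkn⟩]
      simp only [zero_add, Nat.sub_self, Nat.add_sub_cancel' hk] at h1 h2 h3
      exact (h2.mul h3).mul h1.inv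
    · have h1 := hg.after (k - (n - 1)) (by omega) (by omega)
      have h2 := hh.after (k - (n - 1) - l) (by omega) (by omega)
      have h3 := hf.le (k - (n - 1)) (by omega) (by omega)
      rw [show k - (n - 1) + (n - 1) = k by omega] at h1
      rw [show k - (n - 1) - l + (n - 1) = k - l by omega] at h2
      exact (h2.mul h3).mul h1.inv

theorem rotates_zero (N : ℕ) : Rotates N 0 (1 : T n) :=
  ⟨fun k hk => by omega, fun k _ _ => by simpa using Maps.one _⟩

/-- The generator `c_0`. -/
noncomputable def cGen (n : ℕ) [n.AtLeastTwo] : T n := (cPair n).toT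

theorem combLeaf_one {k : ℕ} (hk : k < n) : combLeaf 1 k = [(⟨k, hk⟩ : Fin n)] := by
  have := combLeaf_last_append 0 (⟨k, hk⟩ : Fin n)
  simpa [combLeaf] using this.symm

theorem maps_cGen {k : ℕ} (hk : k < n) :
    Maps (cGen n) (combLeaf 1 k) (combLeaf 1 ((k + (n - 1)) % n)) := by
  have hn := two_le n
  have hlen : (NTree.caret n).leaves.length = n := numLeaves_caret n
  refine TreePair.maps_toT (p := (_, _)) _ (TreePair.mem_pairs (k := k) _ ?_ ?_)
  · simp only [cPair, LabelledTree.labelled, List.rotate_zero]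
    rw [NTree.getElem?_leaves_caret]
    exact ⟨⟨k, hk⟩, combLeaf_one hk, rfl⟩
  · simp only [cPair, LabelledTree.labelled]
    rw [List.getElem?_rotate (by omega), hlen, NTree.getElem?_leaves_caret]
    exact ⟨⟨_, Nat.mod_lt _ (by omega)⟩, combLeaf_one _, rfl⟩

theorem exists_rotates_one (l : ℕ) (hl : l ≤ n - 1) :
    ∃ f : T n, Rotates 1 l f ∧ WordLE (gens n) l f := by
  have hn := two_le n
  induction l with
  | zero => exact ⟨1, rotates_zero 1, WordLE.one 0⟩
  | succ l ih =>
    obtain ⟨f, hf, hf'⟩ := ih (by omega)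
    refine ⟨cGen n * f, ⟨fun k hk => ?_, fun k hk hkN => ?_⟩, ?_⟩
    · rcases (show k ≤ l by omega).eq_or_lt with rfl | hk'
      · have h1 := maps_cGen (n := n) (k := 0) (by omega)
        have h2 := hf.le k le_rfl (by omega)
        rw [Nat.sub_self] at h2
        rw [zero_add, Nat.mod_eq_of_lt (by omega)] at h1
        rw [show k + (1 * (n - 1) + 1 - (k + 1)) = n - 1 by omega]
        exact h1.mul h2
      · have h2 := hf.lt k hk'
        have h1 := maps_cGen (n := n) (k := k + (1 * (n - 1) + 1 - l)) (by omega)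
        rw [show k + (1 * (n - 1) + 1 - l) + (n - 1) = k + (1 * (n - 1) + 1 - (l + 1)) + n by omega,
          Nat.add_mod_right, Nat.mod_eq_of_lt (by omega)] at h1
        exact h1.mul h2
    · have h2 := hf.le k (by omega) hkN
      have h1 := maps_cGen (n := n) (k := k - l) (by omega)
      rw [show k - l + (n - 1) = k - (l + 1) + n by omega,
          Nat.add_mod_right, Nat.mod_eq_of_lt (by omega)] at h1
      exact h1.mul h2
    · rw [add_comm]
      exact (WordLE.of_mem (Set.mem_insert _ _)).mul hf'

/-- The angle `l + q * (n - 1)` is reached with `q + 1` carets. The image of the first leaf is the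
leaf `n - l` in every step, so that it is always split by a generator (or by the identity). -/
theorem exists_rotates_of_splits_zero {l : ℕ} (h0 : 0 < l) (hl : l ≤ n - 1) (q : ℕ) :
    ∃ f : T n, Rotates (q + 1) (l + q * (n - 1)) f ∧
      WordLE (gens n) (q + l) (f * shift n ^ q) := by
  have hn := two_le n
  induction q with
  | zero => simpa using exists_rotates_one l hl
  | succ q ih =>
    obtain ⟨f, hf, hf'⟩ := ih
    have e : (q + 1) * (n - 1) + 1 - (l + q * (n - 1)) = n - l := by rw [Nat.succ_mul]; omega
    obtain ⟨h, hh, hh'⟩ := exists_splits (n := n) (q + 1) (n - l) (by rw [Nat.succ_mul]; omega)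
    rw [level_eq_zero (by omega)] at hh'
    refine ⟨h * f * (shift n)⁻¹, ?_, ?_⟩
    · rw [Nat.succ_mul, ← add_assoc l]
      exact hf.split_zero (by omega) (by rw [Nat.succ_mul]; omega) (splits_shift q) (e ▸ hh)
    · convert (hh'.mul hf') using 1
      · ring
      · rw [pow_succ']
        group

/-- The number of carets is increased at a fixed angle. The leaf that is split is always the same
one, so that the shifts which bring it to a generator are paid only once. -/
theorem exists_rotates_of_splits_self {l q : ℕ} (h0 : 0 < l) (hl : l ≤ n - 1) (p : ℕ) :
    ∃ f : T n, Rotates (q + 1 + p) (l + q * (n - 1)) f ∧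
      WordLE (gens n) (q + l + 2 * p) (f * shift n ^ q) := by
  have hn := two_le n
  induction p with
  | zero => exact exists_rotates_of_splits_zero h0 hl q
  | succ p ih =>
    obtain ⟨f, hf, hf'⟩ := ih
    have hN : l + q * (n - 1) ≤ (q + 1 + p) * (n - 1) := by
      rw [add_mul, Nat.succ_mul]
      omega
    obtain ⟨g, hg, hg'⟩ := exists_splits (n := n) _ _ hN
    have e : level n (l + q * (n - 1)) = q := by
      rw [level, show l + q * (n - 1) - 1 = l - 1 + q * (n - 1) by omega,
        Nat.add_mul_div_right _ _ (by omega), Nat.div_eq_of_lt (by omega), zero_add]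
    rw [e] at hg'
    have hs := splits_shift (n := n) (q + p)
    rw [show q + p + 1 = q + 1 + p by omega] at hs
    refine ⟨shift n * f * g⁻¹, hf.split_self hN hg hs, ?_⟩
    convert (wordLE_shift.mul (hf'.mul hg'.inv)) using 1
    · ring
    · group

/-- Every rotation has linear length, uniformly in the angle. -/
theorem exists_rotates (N l : ℕ) (hl : l ≤ N * (n - 1)) :
    ∃ f : T n, Rotates N l f ∧ WordLE (gens n) (2 * N + n) f := by
  have hn := two_le n
  rcases Nat.eq_zero_or_pos l with rfl | h0
  · exact ⟨1, rotates_zero N, WordLE.one _⟩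
  set q := (l - 1) / (n - 1) with hq
  have h1 := Nat.div_add_mod' (l - 1) (n - 1)
  rw [← hq] at h1
  have h2 : (l - 1) % (n - 1) < n - 1 := Nat.mod_lt _ (by omega)
  have hqN : q < N := by
    refine lt_of_mul_lt_mul_right (a := n - 1) ?_ (Nat.zero_le _)
    omega
  obtain ⟨p, rfl⟩ := Nat.exists_eq_add_of_lt hqN
  obtain ⟨f, hf, hf'⟩ := exists_rotates_of_splits_self (n := n) (q := q)
    (l := (l - 1) % (n - 1) + 1) (by omega) (by omega) p
  refine ⟨f, ?_, ?_⟩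
  · rw [show (l - 1) % (n - 1) + 1 + q * (n - 1) = l by omega,
      show q + 1 + p = q + p + 1 by omega] at hf
    exact hf
  · convert (hf'.mul (wordLE_shift_pow q).inv).mono (k' := 2 * (q + p + 1) + n) (by omega) using 1
    group

theorem Rotates.maps {N l : ℕ} {f : T n} (hf : Rotates N l f) (hl : l ≤ N * (n - 1)) {k k' : ℕ}
    (hk : k ≤ N * (n - 1)) (hk' : k' ≤ N * (n - 1)) (h : k' + l ≡ k [MOD N * (n - 1) + 1]) :
    Maps f (combLeaf N k) (combLeaf N k') := by
  by_cases hlt : k' + l ≤ N * (n - 1)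
  · obtain rfl := h.eq_of_lt_of_lt (by omega) (by omega)
    have := hf.le (k' + l) (by omega) hk
    rwa [Nat.add_sub_cancel] at this
  · have h2 : k' + l - (N * (n - 1) + 1) ≡ k [MOD N * (n - 1) + 1] := by
      refine Nat.ModEq.trans ?_ h
      conv_rhs => rw [← Nat.sub_add_cancel (show N * (n - 1) + 1 ≤ k' + l by omega)]
      exact (Nat.add_modEq_right).symm
    obtain rfl := h2.eq_of_lt_of_lt (by omega) (by omega)
    have := hf.lt (k' + l - (N * (n - 1) + 1)) (by omega)
    rwa [show k' + l - (N * (n - 1) + 1) + (N * (n - 1) + 1 - l) = k' by omega] at this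

/-- The word length is bounded in terms of the number of carets: straighten the source tree,
rotate the all-right tree, and undo the straightening of the target tree. -/
theorem wordLE_of_represents {P : TreePair n} {g : T n}
    (hg : P.Represents (g : UnitAddCircle ≃ₜ UnitAddCircle)) :
    WordLE (gens n) (8 * P.source.tree.carets + n) g := by
  have hn := two_le n
  obtain ⟨f, hf, hf'⟩ := exists_straighten P.source.tree
  obtain ⟨h, hh, hh'⟩ := exists_straighten P.target.tree
  have hs := P.source.tree.numLeaves_eq_carets
  have ht := P.target.tree.numLeaves_eq_carets
  have hc : P.target.tree.carets = P.source.tree.carets := by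
    have := P.numLeaves_eq
    rw [hs, ht, Nat.add_right_cancel_iff] at this
    exact (Nat.eq_of_mul_eq_mul_right (by omega) this).symm
  rw [hc] at hh hh' ht
  set N := P.source.tree.carets
  set L := N * (n - 1) + 1 with hL
  set l := (P.source.zero + (L - P.target.zero % L)) % L with hl
  have hlL : l < L := Nat.mod_lt _ (by omega)
  obtain ⟨r, hr, hr'⟩ := exists_rotates (n := n) N l (by omega)
  have key : g = h⁻¹ * r * f := by
    refine hg.eq_of_maps fun p hp => ?_
    obtain ⟨k, -, h1, h2⟩ := P.exists_getElem?_of_mem_pairs hp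
    rw [hs] at h1
    rw [ht] at h2
    have h3 : (k + P.source.zero) % L < L := Nat.mod_lt _ (by omega)
    have h4 : (k + P.target.zero) % L < L := Nat.mod_lt _ (by omega)
    refine ((hh' _ _ h2).inv.mul (hr.maps (by omega) (by omega) (by omega) ?_)).mul (hf' _ _ h1)
    rw [← hL]
    have h5 : P.target.zero % L < L := Nat.mod_lt _ (by omega)
    calc (k + P.target.zero) % L + l
        ≡ (k + P.target.zero % L) + (P.source.zero + (L - P.target.zero % L)) [MOD L] :=
          Nat.ModEq.add ((Nat.mod_modEq _ _).trans ((Nat.mod_modEq _ _).symm.add_left _))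
            (Nat.mod_modEq _ _)
      _ = k + P.source.zero + L := by omega
      _ ≡ k + P.source.zero [MOD L] := Nat.add_modEq_right
      _ ≡ (k + P.source.zero) % L [MOD L] := (Nat.mod_modEq _ _).symm
  rw [key]
  exact ((hh.inv.mul hr').mul hf).mono (by omega)

end

/-! ### Inner vertices of trees -/

/-- The addresses of the inner vertices of a tree. -/
def NTree.inner {n : ℕ} : NTree n → List (List (Fin n))
  | leaf => []
  | node c => [] :: (List.finRange n).flatMap fun j => (inner (c j)).map fun w => j :: w

theorem NTree.length_inner {n : ℕ} (U : NTree n) : U.inner.length = U.carets := by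
  induction U with
  | leaf => rfl
  | node c ih =>
    simp only [inner, carets, List.length_cons, List.length_flatMap, List.length_map, ih,
      Fin.sum_univ_def]
    ring

theorem NTree.nodup_inner {n : ℕ} (U : NTree n) : U.inner.Nodup := by
  induction U with
  | leaf => simp [inner]
  | node c ih =>
    rw [inner, List.nodup_cons, List.nodup_flatMap]
    refine ⟨by simp, fun j _ => (ih j).map fun a b h => by simpa using h, ?_⟩
    refine (List.nodup_finRange n).imp ?_
    intro i j hij w hi hj
    simp only [List.mem_map] at hi hj
    obtain ⟨a, -, rfl⟩ := hi
    obtain ⟨b, -, h⟩ := hj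
    simp only [List.cons.injEq] at h
    exact hij h.1.symm

theorem NTree.mem_leaves_node {n : ℕ} {c : Fin n → NTree n} {j : Fin n} {w : List (Fin n)} :
    j :: w ∈ (node c).leaves ↔ w ∈ (c j).leaves := by
  simp [leaves]

theorem NTree.mem_inner_node {n : ℕ} {c : Fin n → NTree n} {j : Fin n} {w : List (Fin n)} :
    j :: w ∈ (node c).inner ↔ w ∈ (c j).inner := by
  simp [inner]

theorem NTree.mem_inner_or_exists_leaf {n : ℕ} (U : NTree n) : ∀ w : List (Fin n),
    w ∈ U.inner ∨ ∃ a ∈ U.leaves, ∃ s, w = a ++ s := by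
  induction U with
  | leaf => intro w; exact Or.inr ⟨[], by simp [leaves], w, rfl⟩
  | node c ih =>
    intro w
    cases w with
    | nil => exact Or.inl (by simp [inner])
    | cons j w =>
      rcases ih j w with h | ⟨a, ha, s, rfl⟩
      · exact Or.inl (mem_inner_node.2 h)
      · exact Or.inr ⟨j :: a, mem_leaves_node.2 ha, s, rfl⟩

/-- Below every vertex there is a tree whose leaves are at or below the leaves of `U`. -/
theorem NTree.exists_refines {n : ℕ} (U : NTree n) : ∀ w : List (Fin n), ∃ h : NTree n,
    ∀ s ∈ h.leaves, ∃ a ∈ U.leaves, ∃ r, w ++ s = a ++ r := by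
  induction U with
  | leaf => intro w; exact ⟨leaf, fun s _ => ⟨[], by simp [leaves], w ++ s, rfl⟩⟩
  | node c ih =>
    intro w
    cases w with
    | nil => exact ⟨node c, fun s hs => ⟨s, hs, [], by simp⟩⟩
    | cons j w =>
      obtain ⟨h, hh⟩ := ih j w
      refine ⟨h, fun s hs => ?_⟩
      obtain ⟨a, ha, r, e⟩ := hh s hs
      exact ⟨j :: a, mem_leaves_node.2 ha, r, by rw [List.cons_append, e, List.cons_append]⟩

theorem NTree.eq_leaf_of_nil_mem {n : ℕ} {U : NTree n} (h : [] ∈ U.leaves) : U = leaf := by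
  cases U with
  | leaf => rfl
  | node c => simp [leaves] at h

/-- At or below every inner vertex there is a caret all of whose leaves are leaves of the tree. -/
theorem NTree.exists_exposed {n : ℕ} (U : NTree n) : ∀ w ∈ U.inner, ∃ s : List (Fin n),
    ∀ j : Fin n, w ++ s ++ [j] ∈ U.leaves := by
  induction U with
  | leaf => intro w hw; simp [inner] at hw
  | node c ih =>
    intro w hw
    cases w with
    | cons j w =>
      obtain ⟨s, hs⟩ := ih j w (mem_inner_node.1 hw)
      exact ⟨s, fun i => by simpa using mem_leaves_node.2 (hs i)⟩
    | nil =>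
      by_cases h : ∃ j, c j ≠ leaf
      · obtain ⟨j, hj⟩ := h
        obtain ⟨s, hs⟩ := ih j [] (by
          cases hc : c j with
          | leaf => exact absurd hc hj
          | node d => simp [inner])
        exact ⟨j :: s, fun i => by simpa using mem_leaves_node.2 (hs i)⟩
      · push Not at h
        exact ⟨[], fun i => by
          simpa using mem_leaves_node.2 (show [] ∈ (c i).leaves by rw [h i]; simp [leaves])⟩

/-- Removing a caret all of whose leaves are leaves of the tree. -/
theorem NTree.exists_collapse {n : ℕ} [NeZero n] (U : NTree n) : ∀ b : List (Fin n),
    (∀ j : Fin n, b ++ [j] ∈ U.leaves) → ∃ (A B : List (List (Fin n))) (U' : NTree n),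
      U.leaves = A ++ ((List.finRange n).map fun j => b ++ [j]) ++ B ∧
      U'.leaves = A ++ [b] ++ B := by
  induction U with
  | leaf =>
    intro b hb
    have := hb ⟨0, NeZero.pos n⟩
    simp [leaves] at this
  | node c ih =>
    intro b hb
    cases b with
    | nil =>
      have hc : c = fun _ => leaf := by
        funext j
        exact eq_leaf_of_nil_mem (mem_leaves_node.1 (hb j))
      refine ⟨[], [], leaf, ?_, by simp [leaves]⟩
      simp [hc, leaves]
      exact List.flatMap_pure_eq_map _ _
    | cons i b =>
      obtain ⟨A, B, U', h1, h2⟩ := ih i b fun j => mem_leaves_node.1 (hb j)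
      obtain ⟨l₁, l₂, hl⟩ := List.append_of_mem (List.mem_finRange i)
      have hnd := List.nodup_finRange n
      rw [hl, List.nodup_middle, List.nodup_cons, List.mem_append, not_or] at hnd
      obtain ⟨⟨hi1, hi2⟩, -⟩ := hnd
      have hne : ∀ l : List (Fin n), i ∉ l →
          (l.flatMap fun j => (Function.update c i U' j).leaves.map fun w => j :: w) =
            l.flatMap fun j => (c j).leaves.map fun w => j :: w := by
        intro l hil
        refine List.flatMap_congr fun j hj => ?_
        rw [Function.update_of_ne (ne_of_mem_of_not_mem hj hil)]
      refine ⟨(l₁.flatMap fun j => (c j).leaves.map fun w => j :: w) ++ A.map fun w => i :: w,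
        (B.map fun w => i :: w) ++ l₂.flatMap fun j => (c j).leaves.map fun w => j :: w,
        node (Function.update c i U'), ?_, ?_⟩
      · rw [leaves, hl, List.flatMap_append, List.flatMap_cons, h1]
        rw [← hl]
        simp [Function.comp_def]
      · rw [leaves, hl, List.flatMap_append, List.flatMap_cons, hne _ hi1, hne _ hi2,
          Function.update_self, h2]
        simp

theorem eq_of_isRotated_of_head {α : Type*} {a : α} {l l' : List α} (hl : (a :: l).Nodup)
    (h : a :: l ~r a :: l') : l = l' := by
  obtain ⟨k, hk, e⟩ := List.isRotated_iff_mod.1 h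
  rcases hk.eq_or_lt with rfl | hk
  · rw [List.rotate_length] at e
    simpa using e
  have h1 : (a :: l)[k]? = some a := by
    have := List.getElem?_rotate (l := a :: l) (n := k) (m := 0) (by simp)
    rw [e, zero_add, Nat.mod_eq_of_lt hk] at this
    simpa using this.symm
  have h2 : k = 0 := by
    obtain ⟨hk', h1⟩ := List.getElem?_eq_some_iff.1 h1
    exact (hl.getElem_inj_iff (hi := hk') (hj := by simp)).1 (by simpa using h1)
  subst h2
  simpa using e

theorem map_snd_eq_map_of_map_fst {α β ι : Type*} {F : ι → α} {G : ι → β} {l : List ι} :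
    ∀ {L : List (α × β)}, L.map Prod.fst = l.map F →
      (∀ p ∈ L, ∀ j, p.1 = F j → p.2 = G j) → L.map Prod.snd = l.map G := by
  induction l with
  | nil => intro L h _; simpa using h
  | cons i l ih =>
    intro L h hL
    cases L with
    | nil => simp at h
    | cons p L =>
      rw [List.map_cons, List.map_cons, List.cons.injEq] at h
      rw [List.map_cons, List.map_cons, hL p List.mem_cons_self i h.1,
        ih h.2 fun q hq => hL q (List.mem_cons_of_mem _ hq)]

section

variable {n : ℕ} [n.AtLeastTwo]

theorem TreePair.length_pairs (P : TreePair n) :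
    P.pairs.length = P.source.tree.carets * (n - 1) + 1 := by
  rw [← NTree.numLeaves_eq_carets, ← List.length_map (f := Prod.fst), P.map_fst_pairs,
    LabelledTree.labelled, List.length_rotate, NTree.numLeaves]

/-! ### Breaks and complexity -/

/-- The addresses of the intervals which `f` does not map affinely onto `n`-adic intervals. These
are the inner vertices of the source tree of the reduced tree pair of `f`. -/
def breaks (f : T n) : Set (List (Fin n)) := {w | ¬ ∃ v, Maps f w v}

theorem breaks_subset_inner {P : TreePair n} {f : T n}
    (h : P.Represents (f : UnitAddCircle ≃ₜ UnitAddCircle)) :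
    breaks f ⊆ {w | w ∈ P.source.tree.inner} := by
  intro w hw
  refine (P.source.tree.mem_inner_or_exists_leaf w).resolve_right ?_
  rintro ⟨a, ha, s, rfl⟩
  have ha' : a ∈ P.pairs.map Prod.fst := by
    rw [P.map_fst_pairs]
    exact List.mem_rotate.2 ha
  obtain ⟨p, hp, rfl⟩ := List.mem_map.1 ha'
  exact hw ⟨p.2 ++ s, Maps.append (h p hp) s⟩

theorem finite_breaks (f : T n) : (breaks f).Finite := by
  obtain ⟨P, hP⟩ := f.2
  exact (List.finite_toSet _).subset (breaks_subset_inner hP)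

/-- The number of carets of the reduced tree pair of `f`. -/
noncomputable def complexity (f : T n) : ℕ := (breaks f).ncard

theorem complexity_le_carets {P : TreePair n} {f : T n}
    (h : P.Represents (f : UnitAddCircle ≃ₜ UnitAddCircle)) :
    complexity f ≤ P.source.tree.carets := by
  classical
  rw [← NTree.length_inner]
  calc complexity f ≤ ((P.source.tree.inner.toFinset : Finset _) : Set (List (Fin n))).ncard :=
        Set.ncard_le_ncard (by simpa using breaks_subset_inner h) (Finset.finite_toSet _)
    _ ≤ _ := by
        rw [Set.ncard_coe_finset]
        exact List.toFinset_card_le _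

/-- The vertex `w` is a break of `g * f` only if it is a break of `f`, or `f` maps it to a break
of `g`. -/
theorem complexity_mul_le (g f : T n) : complexity (g * f) ≤ complexity f + complexity g := by
  classical
  set F : List (Fin n) → List (Fin n) := fun v => if h : ∃ w, Maps f w v then h.choose else []
    with hF
  have hsub : breaks (g * f) ⊆ breaks f ∪ F '' breaks g := by
    intro w hw
    by_cases h : ∃ v, Maps f w v
    · obtain ⟨v, hv⟩ := h
      refine Or.inr ⟨v, fun ⟨u, hu⟩ => hw ⟨u, hu.mul hv⟩, ?_⟩
      have h' : ∃ w, Maps f w v := ⟨w, hv⟩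
      simp only [hF, dif_pos h']
      exact h'.choose_spec.inv.right_unique hv.inv
    · exact Or.inl h
  calc complexity (g * f) ≤ (breaks f ∪ F '' breaks g).ncard :=
        Set.ncard_le_ncard hsub ((finite_breaks f).union ((finite_breaks g).image F))
    _ ≤ (breaks f).ncard + (F '' breaks g).ncard := Set.ncard_union_le _ _
    _ ≤ complexity f + complexity g :=
        Nat.add_le_add_left (Set.ncard_image_le (finite_breaks g)) _

/-- If `f` maps the interval of an inner vertex of the source tree affinely onto an `n`-adic
interval, then a caret can be removed from both trees. -/
theorem exists_shorter {P : TreePair n} {f : T n}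
    (h : P.Represents (f : UnitAddCircle ≃ₜ UnitAddCircle)) {w : List (Fin n)}
    (hw : w ∈ P.source.tree.inner) (hwf : w ∉ breaks f) : ∃ P' : TreePair n,
      P'.Represents (f : UnitAddCircle ≃ₜ UnitAddCircle) ∧ P'.pairs.length < P.pairs.length := by
  have hn := two_le n
  obtain ⟨v, hv⟩ := not_not.1 hwf
  obtain ⟨s, hs⟩ := P.source.tree.exists_exposed w hw
  set a := w ++ s
  set b := v ++ s
  have hab : Maps f a b := hv.append s
  have hU : P.pairs.map Prod.fst ~r P.source.tree.leaves := by
    rw [P.map_fst_pairs]; exact List.IsRotated.forall _ _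
  have hV : P.pairs.map Prod.snd ~r P.target.tree.leaves := by
    rw [P.map_snd_pairs]; exact List.IsRotated.forall _ _
  have hval : ∀ p ∈ P.pairs, ∀ j : Fin n, p.1 = a ++ [j] → p.2 = b ++ [j] := by
    intro p hp j hj
    have h1 : Maps f p.1 p.2 := h p hp
    rw [hj] at h1
    exact h1.right_unique (hab.append [j])
  obtain ⟨A, B, U', hA, hU'⟩ := P.source.tree.exists_collapse a hs
  obtain ⟨C, D, V', hC, hV'⟩ := P.target.tree.exists_collapse b (by
    intro j
    have h1 := hs j
    rw [← hU.mem_iff, List.mem_map] at h1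
    obtain ⟨p, hp, hpj⟩ := h1
    rw [← hV.mem_iff, ← hval p hp j hpj]
    exact List.mem_map.2 ⟨p, hp, rfl⟩)
  -- rotate the list of pairs so that the pairs of leaves of the caret come first
  have hrot : P.pairs.map Prod.fst ~r ((List.finRange n).map fun j => a ++ [j]) ++ (B ++ A) := by
    refine hU.trans ?_
    rw [hA, List.append_assoc, ← List.append_assoc _ B A]
    exact List.isRotated_append
  obtain ⟨k, hk⟩ := hrot
  rw [← List.map_rotate, List.map_eq_append_iff] at hk
  obtain ⟨L, R, hLR, hL, hR⟩ := hk
  have hmem : ∀ p, p ∈ L ++ R → p ∈ P.pairs := fun p hp => by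
    rw [← hLR] at hp
    exact List.mem_rotate.1 hp
  have hL' : L.map Prod.snd = (List.finRange n).map fun j => b ++ [j] :=
    map_snd_eq_map_of_map_fst hL fun p hp => hval p (hmem p (List.mem_append_left _ hp))
  have hR' : R.map Prod.snd = D ++ C := by
    have h1 : ((List.finRange n).map fun j => b ++ [j]) ++ R.map Prod.snd ~r
        ((List.finRange n).map fun j => b ++ [j]) ++ (D ++ C) := by
      rw [← hL', ← List.map_append, ← hLR, List.map_rotate, hL']
      refine ((List.IsRotated.forall _ _).trans hV).trans ?_
      rw [hC, List.append_assoc, ← List.append_assoc _ D C]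
      exact List.isRotated_append
    have h2 : (((List.finRange n).map fun j => b ++ [j]) ++ R.map Prod.snd).Nodup := by
      rw [← hL', ← List.map_append, ← hLR, List.map_rotate]
      exact List.nodup_rotate.2 (hV.nodup_iff.2 P.target.tree.nodup_leaves)
    -- the two lists start with the same element, so the rotation between them is trivial
    obtain ⟨x, t, hx⟩ := List.exists_cons_of_ne_nil
      (List.ne_nil_of_mem (List.mem_finRange (lastDir n)))
    rw [hx] at h1 h2
    exact List.append_cancel_left (eq_of_isRotated_of_head h2 h1)
  have hpair : IsPairing ((a, b) :: R) := by
    refine ⟨U', V', ?_, ?_⟩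
    · rw [hU', List.map_cons, hR, List.append_assoc, ← List.cons_append]
      exact List.isRotated_append
    · rw [hV', List.map_cons, hR', List.append_assoc, ← List.cons_append]
      exact List.isRotated_append
  obtain ⟨P', hP'⟩ := hpair.exists_treePair
  refine ⟨P', fun p hp => ?_, ?_⟩
  · rw [hP', List.mem_cons] at hp
    rcases hp with rfl | hp
    · exact hab
    · exact h p (hmem p (List.mem_append_right _ hp))
  · have h1 := congrArg List.length hLR
    have h2 := congrArg List.length hL
    rw [List.length_rotate, List.length_append] at h1
    rw [List.length_map, List.length_map, List.length_finRange] at h2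
    rw [hP', List.length_cons]
    omega

/-- A smallest tree pair is reduced: its inner vertices are exactly the breaks. -/
theorem exists_carets_le_complexity (f : T n) : ∃ P : TreePair n,
    P.Represents (f : UnitAddCircle ≃ₜ UnitAddCircle) ∧
      P.source.tree.carets ≤ complexity f := by
  classical
  have hex : ∃ k, ∃ P : TreePair n, P.Represents (f : UnitAddCircle ≃ₜ UnitAddCircle) ∧
      P.pairs.length = k := by
    obtain ⟨P, hP⟩ := f.2
    exact ⟨_, P, hP, rfl⟩
  obtain ⟨P, hP, hlen⟩ := Nat.find_spec hex
  refine ⟨P, hP, ?_⟩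
  have hsub : ((P.source.tree.inner.toFinset : Finset _) : Set (List (Fin n))) ⊆ breaks f := by
    intro w hw
    by_contra hwf
    obtain ⟨P', hP', hlt⟩ := exists_shorter hP (by simpa using hw) hwf
    exact Nat.find_min hex (hlen ▸ hlt) ⟨P', hP', rfl⟩
  rw [← NTree.length_inner, ← List.toFinset_card_of_nodup (NTree.nodup_inner _),
    ← Set.ncard_coe_finset]
  exact Set.ncard_le_ncard hsub (finite_breaks f)

theorem complexity_inv_le (f : T n) : complexity f⁻¹ ≤ complexity f := by
  have hn := two_le n
  obtain ⟨P, hP, hle⟩ := exists_carets_le_complexity f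
  obtain ⟨Q, hQ⟩ := P.isPairing.swap.exists_treePair
  have hQf : Q.Represents ((f⁻¹ : T n) : UnitAddCircle ≃ₜ UnitAddCircle) := by
    intro p hp
    rw [hQ] at hp
    exact Rep.swap hP p hp
  refine (complexity_le_carets hQf).trans (le_trans (le_of_eq ?_) hle)
  have h1 := Q.length_pairs
  rw [hQ, List.length_map, P.length_pairs, Nat.add_right_cancel_iff] at h1
  exact (Nat.eq_of_mul_eq_mul_right (by omega) h1).symm

theorem complexity_one : complexity (1 : T n) = 0 := by
  have : breaks (1 : T n) = ∅ :=
    Set.eq_empty_of_forall_notMem fun w hw => hw ⟨w, Maps.one w⟩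
  rw [complexity, this, Set.ncard_empty]

theorem carets_of_numLeaves {U : NTree n} {k : ℕ} (h : U.numLeaves = k * (n - 1) + 1) :
    U.carets = k := by
  have hn := two_le n
  rw [NTree.numLeaves_eq_carets, Nat.add_right_cancel_iff] at h
  exact Nat.eq_of_mul_eq_mul_right (by omega) h

theorem complexity_gens_le {s : T n} (hs : s ∈ gens n) : complexity s ≤ 3 := by
  have hn := two_le n
  have hc := numLeaves_caret n
  rcases hs with rfl | ⟨i, rfl⟩
  · refine (complexity_le_carets (cPair n).represents_toT).trans ?_
    simp [cPair, NTree.carets_caret]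
  · refine (complexity_le_carets (xPair n i).represents_toT).trans ?_
    by_cases hi : (i : ℕ) < n - 1
    · rw [show xPair n i = _ from if_pos hi]
      refine (carets_of_numLeaves (k := 2) ?_).le.trans (by omega)
      rw [NTree.numLeaves_twoCarets i.2]
      omega
    · rw [show xPair n i = _ from if_neg hi]
      refine (carets_of_numLeaves (k := 3) ?_).le
      rw [NTree.numLeaves_underLast, NTree.numLeaves_twoCarets (by omega)]
      omega

theorem complexity_prod_le (l : List (T n)) (hl : ∀ s ∈ l, s ∈ gens n ∨ s⁻¹ ∈ gens n) :
    complexity l.prod ≤ 3 * l.length := by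
  induction l with
  | nil => simp [complexity_one]
  | cons s l ih =>
    have h1 := ih fun t ht => hl t (List.mem_cons_of_mem _ ht)
    have h2 : complexity s ≤ 3 := by
      rcases hl s List.mem_cons_self with h | h
      · exact complexity_gens_le h
      · rw [← inv_inv s]
        exact (complexity_inv_le _).trans (complexity_gens_le h)
    have h3 := complexity_mul_le s l.prod
    rw [List.prod_cons, List.length_cons]
    omega

theorem wordLE_complexity (f : T n) : WordLE (gens n) (8 * complexity f + n) f := by
  obtain ⟨P, hP, hle⟩ := exists_carets_le_complexity f
  exact (wordLE_of_represents hP).mono (by omega)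

theorem closure_gens (n : ℕ) [n.AtLeastTwo] : Subgroup.closure (gens n) = ⊤ :=
  (Subgroup.eq_top_iff' _).2 fun f => (wordLE_complexity f).mem_closure

theorem wordLength_le (f : T n) : wordLength (gens n) f ≤ 8 * complexity f + n :=
  (wordLE_complexity f).wordLength_le

theorem complexity_le_wordLength (f : T n) : complexity f ≤ 3 * wordLength (gens n) f := by
  obtain ⟨l, hl, rfl, hlen⟩ := (wordLE_complexity f).exists_word
  rw [← hlen]
  exact complexity_prod_le l hl

/-! ### Caret replacement -/

/-- The addresses of the leaves of the all-right binary tree form a prefix code. -/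
theorem combCode_append_inj (m : ℕ) : ∀ (i j : Fin m) (x y : List (Fin 2)),
    NTree.combCode m i ++ x = NTree.combCode m j ++ y → i = j := by
  induction m with
  | zero => intro i; exact i.elim0
  | succ m ih =>
    cases m with
    | zero => intro i j _ _ _; omega
    | succ m =>
      intro i j x y h
      induction i using Fin.cases with
      | zero =>
        induction j using Fin.cases with
        | zero => rfl
        | succ j => simp [NTree.combCode] at h
      | succ i =>
        induction j using Fin.cases with
        | zero => simp [NTree.combCode] at h
        | succ j =>
          simp only [NTree.combCode, Fin.cases_succ, List.cons_append, List.cons.injEq,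
            true_and] at h
          rw [ih i j x y h]

theorem combCode_ne_nil (i : Fin n) : NTree.combCode n i ≠ [] := by
  obtain ⟨m, rfl⟩ := Nat.exists_eq_add_of_le' (two_le n)
  induction i using Fin.cases <;> simp [NTree.combCode]

theorem code_cons (j : Fin n) (w : List (Fin n)) :
    NTree.code (j :: w) = NTree.combCode n j ++ NTree.code w := by
  simp [NTree.code]

theorem code_injective : Function.Injective (NTree.code (n := n)) := by
  intro w
  induction w with
  | nil =>
    intro v h
    cases v with
    | nil => rfl
    | cons j v =>
      rw [code_cons] at h
      exact absurd (List.append_eq_nil_iff.1 h.symm).1 (combCode_ne_nil j)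
  | cons i w ih =>
    intro v h
    cases v with
    | nil =>
      rw [code_cons] at h
      exact absurd (List.append_eq_nil_iff.1 h).1 (combCode_ne_nil i)
    | cons j v =>
      rw [code_cons, code_cons] at h
      obtain rfl := combCode_append_inj n i j _ _ h
      rw [ih (List.append_cancel_left h)]

theorem combCode_getLast? (m : ℕ) : ∀ i : Fin (m + 2),
    (NTree.combCode (m + 2) i).getLast? = some (if i = Fin.last (m + 1) then 1 else 0) := by
  induction m with
  | zero => intro i; fin_cases i <;> rfl
  | succ m ih =>
    intro i
    induction i using Fin.cases with
    | zero => simp [NTree.combCode, Fin.ext_iff]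
    | succ i =>
      have h1 := ih i
      rw [NTree.combCode, Fin.cases_succ, List.getLast?_cons, h1]
      simp [Fin.ext_iff]

/-- Among the leaves of the all-right binary tree, the last one is the only one which is a right
child. Therefore an address which becomes a code word when the code word of the last direction is
appended was a code word before. -/
theorem exists_code_of_append_last {v : List (Fin 2)} {u : List (Fin n)}
    (h : v ++ NTree.code [lastDir n] = NTree.code u) : ∃ v' : List (Fin n), v = NTree.code v' := by
  have hlast : NTree.code [lastDir n] = NTree.combCode n (lastDir n) := by simp [NTree.code]
  have hcode : ∀ i : Fin n, (NTree.combCode n i).getLast? =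
      some (if i = lastDir n then 1 else 0) := by
    obtain ⟨m, rfl⟩ := Nat.exists_eq_add_of_le' (two_le n)
    exact combCode_getLast? m
  rw [hlast] at h
  rcases List.eq_nil_or_concat' u with rfl | ⟨u, i, rfl⟩
  · exact absurd (List.append_eq_nil_iff.1 h).2 (combCode_ne_nil _)
  · rw [NTree.code_append, show NTree.code [i] = NTree.combCode n i by simp [NTree.code]] at h
    have h1 := congrArg List.getLast? h
    rw [List.getLast?_append, List.getLast?_append, hcode, hcode, if_pos rfl] at h1
    by_cases hi : i = lastDir n
    · rw [hi] at h
      exact ⟨u, List.append_cancel_right h⟩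
    · simp [hi] at h1

theorem exists_code_of_append_replicate {v : List (Fin 2)} (k : ℕ) : ∀ {u : List (Fin n)},
    v ++ NTree.code (List.replicate k (lastDir n)) = NTree.code u →
      ∃ v' : List (Fin n), v = NTree.code v' := by
  induction k with
  | zero => intro u h; exact ⟨u, by simpa [NTree.code] using h⟩
  | succ k ih =>
    intro u h
    rw [List.replicate_succ', NTree.code_append, ← List.append_assoc] at h
    obtain ⟨u', hu'⟩ := exists_code_of_append_last h
    exact ih hu'

theorem NTree.exists_replicate_mem_leaves (U : NTree n) :
    ∃ k, List.replicate k (lastDir n) ∈ U.leaves := by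
  induction U with
  | leaf => exact ⟨0, by simp [leaves]⟩
  | node c ih =>
    obtain ⟨k, hk⟩ := ih (lastDir n)
    exact ⟨k + 1, mem_leaves_node.2 hk⟩

theorem Maps.of_leaves {f : T n} {w v : List (Fin n)} (U : NTree n)
    (h : ∀ s ∈ U.leaves, Maps f (w ++ s) (v ++ s)) : Maps f w v := by
  intro t ht
  obtain ⟨s, hs, t', ht', rfl⟩ := cover U t ht
  have := h s hs t' ht'
  rwa [point_append, point_append] at this

/-- The caret replacement of an interval which is not mapped affinely onto an `n`-adic interval is
not mapped affinely onto a dyadic interval. -/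
theorem code_mem_breaks_phi {f : T n} {w : List (Fin n)} (hw : w ∈ breaks f) :
    NTree.code w ∈ breaks (phi n f) := by
  rintro ⟨v, hv⟩
  obtain ⟨L, ⟨U, V, hU, hV⟩, hf, hF⟩ := compatible_phi f
  obtain ⟨h, hh⟩ := U.exists_refines w
  have key : ∀ s ∈ h.leaves, ∃ u, Maps f (w ++ s) u ∧ v ++ NTree.code s = NTree.code u := by
    intro s hs
    obtain ⟨a, ha, r, e⟩ := hh s hs
    rw [← hU.mem_iff, List.mem_map] at ha
    obtain ⟨p, hp, rfl⟩ := ha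
    refine ⟨p.2 ++ r, ?_, ?_⟩
    · rw [e]
      exact Maps.append (hf p hp) r
    · have h1 : Maps (phi n f) (NTree.code p.1) (NTree.code p.2) :=
        hF (NTree.code p.1, NTree.code p.2) (List.mem_map.2 ⟨p, hp, rfl⟩)
      have h2 := h1.append (NTree.code r)
      rw [← NTree.code_append, ← e, NTree.code_append, ← NTree.code_append p.2] at h2
      exact (hv.append (NTree.code s)).right_unique h2
  -- the rightmost leaf below `w` shows that `v` is the replacement of an `n`-ary vertex
  obtain ⟨k, hk⟩ := h.exists_replicate_mem_leaves
  obtain ⟨u, -, hu⟩ := key _ hk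
  obtain ⟨v', rfl⟩ := exists_code_of_append_replicate k hu
  refine hw ⟨v', Maps.of_leaves h fun s hs => ?_⟩
  obtain ⟨u, h1, h2⟩ := key s hs
  rw [← NTree.code_append] at h2
  rwa [code_injective h2]

theorem complexity_le_complexity_phi (f : T n) : complexity f ≤ complexity (phi n f) := by
  rw [complexity, ← Set.ncard_image_of_injective _ code_injective]
  refine Set.ncard_le_ncard ?_ (finite_breaks _)
  rintro _ ⟨w, hw, rfl⟩
  exact code_mem_breaks_phi hw

theorem complexity_phi_le (f : T n) : complexity (phi n f) ≤ (n - 1) * complexity f := by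
  obtain ⟨P, hP, hle⟩ := exists_carets_le_complexity f
  have hPf : P.toT = f := (P.represents_toT).eq_of_maps fun p hp => hP p hp
  have h1 : P.caretReplace.Represents ((phi n f : T 2) : UnitAddCircle ≃ₜ UnitAddCircle) := by
    rw [← hPf, phi_toT]
    exact P.caretReplace.represents_toT
  refine (complexity_le_carets h1).trans (le_trans (le_of_eq ?_) (Nat.mul_le_mul_left _ hle))
  refine carets_of_numLeaves ?_
  rw [TreePair.caretReplace, NTree.numLeaves_caretReplace, NTree.numLeaves_eq_carets]
  ring

theorem phi_injective (n : ℕ) [n.AtLeastTwo] : Function.Injective (phi n) := by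
  refine (injective_iff_map_eq_one _).2 fun f hf => ?_
  obtain ⟨L, hL, h1, h2⟩ := compatible_phi f
  have h2' : ∀ p ∈ L, Maps (phi n f) (NTree.code p.1) (NTree.code p.2) := fun p hp =>
    h2 (NTree.code p.1, NTree.code p.2) (List.mem_map.2 ⟨p, hp, rfl⟩)
  rw [hf] at h2'
  refine Subtype.ext (DFunLike.coe_injective (Rep.ext hL h1 fun p hp t ht => ?_))
  rw [code_injective ((h2' p hp).right_unique (Maps.one _))]
  rfl

end

end Thompson

theorem mainTheorem1 (n : ℕ) [n.AtLeastTwo] :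
    Subgroup.closure (Thompson.gens n) = ⊤ ∧
    Subgroup.closure (Thompson.gens 2) = ⊤ ∧
    Function.Injective (Thompson.phi n) ∧
    ∀ g h : Thompson.T n,
      (1 / 45 : ℝ) * Thompson.wordDist (Thompson.gens n) g h - ((n : ℝ) - 1) * (n + 3) / 15 ≤
          Thompson.wordDist (Thompson.gens 2) (Thompson.phi n g) (Thompson.phi n h) ∧
        (Thompson.wordDist (Thompson.gens 2) (Thompson.phi n g) (Thompson.phi n h) : ℝ) ≤
          45 * ((n : ℝ) - 1) * Thompson.wordDist (Thompson.gens n) g h + 15 := by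
  refine ⟨Thompson.closure_gens n, Thompson.closure_gens 2, Thompson.phi_injective n,
    fun g h => ?_⟩
  have hn : (2 : ℝ) ≤ n := by exact_mod_cast Thompson.two_le n
  rw [Thompson.wordDist, Thompson.wordDist, ← map_inv, ← map_mul]
  set f := g⁻¹ * h
  have h1 := Thompson.wordLength_le f
  have h2 := Thompson.complexity_le_wordLength f
  have h3 := Thompson.wordLength_le (Thompson.phi n f)
  have h4 := Thompson.complexity_le_wordLength (Thompson.phi n f)
  have h5 := Thompson.complexity_le_complexity_phi f
  have h6 := Thompson.complexity_phi_le f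
  set a := Thompson.wordLength (Thompson.gens n) f
  set b := Thompson.wordLength (Thompson.gens 2) (Thompson.phi n f)
  constructor
  · have h7 : (a : ℝ) ≤ 24 * b + n := by exact_mod_cast (show a ≤ 24 * b + n by omega)
    have hb : (0 : ℝ) ≤ b := Nat.cast_nonneg b
    nlinarith
  · have h7 : b ≤ 24 * ((n - 1) * a) + 2 := by
      have := Nat.mul_le_mul_left (n - 1) h2
      rw [Nat.mul_left_comm] at this
      omega
    have h8 : (b : ℝ) ≤ 24 * (((n : ℝ) - 1) * a) + 2 := by
      rw [← Nat.cast_pred (NeZero.pos n)]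
      exact_mod_cast h7
    have h9 : (0 : ℝ) ≤ ((n : ℝ) - 1) * a := mul_nonneg (by linarith) (Nat.cast_nonneg a)
    linarith
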